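/- Let $\mathcal H$ be a complex Hilbert space (of finite or infinite dimension). Let $H_0$ be a self-adjoint operator on $\mathcal H$, possibly unbounded, with domain $D$, whose eigenvectors span a dense subspace of $\mathcal H$; let $V$ be a bounded self-adjoint operator, and put $H(\lambda)=H_0+\lambda V$ on $D$ for real $\lambda$. Let $E_0$ be an unperturbed energy whose eigenspace $W=\ker(H_0-E_0)$ has finite dimension $N$, and suppose that every eigenvalue $e\neq E_0$ of $H_0$ satisfies $|e-E_0|\ge d$; fix $0<r<d$. (If $\dim\mathcal H<\infty$, then all these conditions hold for all self-adjoint $H_0$, $V$, every $E_0$, and some $d>0$.) Define closed subspaces $S_n$ (spanned by the states of step $n$) and $K_n$ (spanned by the states of steps $0,\dots,n$) by $S_0=K_0=W$ and $$K_{n+1}=\overline{K_n+\operatorname{span}\{P_eVx : x\in S_n,\ e\in\mathbb R\}},\qquad S_{n+1}=K_{n+1}\cap K_n^{\perp},$$ where $P_e$ is the orthogonal projection onto $\ker(H_0-e)$: one acts with $V$ on the states of step $n$, separates the results according to their unperturbed energy, and orthogonalises against all the earlier steps. Let $G$ be the closed span of all the $S_n$, with orthogonal projection $P_G$. The Hamiltonian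 truncated after step $k$ is the compression $H^{(k)}(\lambda)$ of $H(\lambda)$ to $K_k$, that is, $x\mapsto P_{K_k}H(\lambda)x$ for $x\in D\cap K_k$. Then: 1. (Basis.) There are pairwise disjoint sets $B_0,B_1,\dots$ of eigenvectors of $H_0$ whose union is orthonormal, such that for all $n$ the closed span of $B_n$ is $S_n$ and the closed span of $B_0\cup\dots\cup B_n$ is $K_n$. 2. (Tri-block-diagonal form.) For $x\in S_m$ and $y\in S_n\cap D$ one has $\langle x,H(\lambda)y\rangle=\lambda\langle x,Vy\rangle$ if $m\ne n$, and $\langle x,H(\lambda)y\rangle=0$ if $|m-n|>1$. 3. (Decoupling.) If $\alpha$ is orthogonal to all $S_n$, then $\langle\alpha,Vx\rangle=0$ for all $n$ and all $x\in S_n$, and $\langle\alpha,H(\lambda)x\rangle=0$ for all $\lambda$, all $n$ and all $x\in S_n\cap D$. Moreover $G$ reduces $H(\lambda)$ for every $\lambda$: if $x\in D$, then $P_Gx\in D$ and $H(\lambda)P_Gx=P_GH(\lambda)x$. For all sufficiently small $|\lambda|$, every eigenvector of $H(\lambda)$ with eigenvalue in $(E_0-r,E_0+r)$ lies in $G$.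 4. (Accuracy.) For all sufficiently small $|\lambda|$, the operator $H(\lambda)$ has exactly $N$ eigenvalues $\mu_1(\lambda)\le\dots\le\mu_N(\lambda)$ in $(E_0-r,E_0+r)$, counted with multiplicity. For every $k\ge0$, for all sufficiently small $|\lambda|$ (depending on $k$), so does $H^{(k)}(\lambda)$, with eigenvalues $\nu_1(\lambda)\le\dots\le\nu_N(\lambda)$, and $$\mu_i(\lambda)-\nu_i(\lambda)=O(\lambda^{2k+2})\qquad(\lambda\to0,\ i=1,\dots,N).$$ 5. (Perturbation corrections.) Let $k\ge0$, and suppose that $\tilde\mu_1,\dots,\tilde\mu_N$ and $\tilde\nu_1,\dots,\tilde\nu_N$ are real functions, analytic at $0$, which for all $\lambda$ near $0$ list with multiplicity the eigenvalues in $(E_0-r,E_0+r)$ of $H(\lambda)$ and of $H^{(k)}(\lambda)$, respectively. Then, for some permutation $\sigma$ of $\{1,\dots,N\}$, the Taylor coefficients at $\lambda=0$ of $\tilde\mu_i$ and $\tilde\nu_{\sigma(i)}$ agree in all orders $m\le 2k+1$, for every $i$. -/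

import Mathlib

open Filter Topology Asymptotics

namespace SCE

variable {E : Type*} [NormedAddCommGroup E] [InnerProductSpace ℂ E]

/-- The eigenstates of a (possibly unbounded) operator `A` with energy `e`, together with `0`:
all `x` in the domain of `A` with `A x = e x`. -/
def energySpace (A : E →ₗ.[ℂ] E) (e : ℝ) : Submodule ℂ E :=
  (LinearMap.ker (A.toFun - (e : ℂ) • A.domain.subtype)).map A.domain.subtype

/-- The Hamiltonian `H₀ + lam V`, with the domain of `H₀`. -/
def hamiltonian (H₀ : E →ₗ.[ℂ] E) (V : E →L[ℂ] E) (lam : ℝ) : E →ₗ.[ℂ] E where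
  domain := H₀.domain
  toFun := H₀.toFun + ((lam : ℂ) • (V : E →ₗ[ℂ] E)) ∘ₗ H₀.domain.subtype

/-- Given real numbers `μ 0, …, μ (N - 1)`: they are exactly the eigenvalues of `A` in the open
interval `(e - r, e + r)`, each listed as often as its multiplicity. -/
def IsEnergyList (A : E →ₗ.[ℂ] E) (e r : ℝ) {N : ℕ} (μ : Fin N → ℝ) : Prop :=
  (∀ i, |μ i - e| < r) ∧
    ∀ x : ℝ, |x - e| < r →
      Module.rank ℂ (energySpace A x) = ((Finset.univ.filter fun i => μ i = x).card : Cardinal)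

variable [CompleteSpace E]

/-- Orthogonal projection onto (the closure of) a subspace, as an operator on the whole space. -/
noncomputable def proj (K : Submodule ℂ E) : E →L[ℂ] E :=
  K.topologicalClosure.starProjection

/-- The states obtained by acting with `V` on the states in `S` and separating the result into its
components of definite unperturbed energy. -/
noncomputable def newStates (H₀ : E →ₗ.[ℂ] E) (V : E →L[ℂ] E) (S : Submodule ℂ E) :
    Submodule ℂ E :=
  Submodule.span ℂ {y | ∃ x ∈ S, ∃ e : ℝ, y = proj (energySpace H₀ e) (V x)}

/-- The procedure. The second component at `n` is the space spanned by the states of step `n`,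
the first one is the space spanned by the states of all the steps `0, …, n`. Step `0` is the
unperturbed energy space of energy `E₀`; step `n + 1` arises from the new states produced by
step `n`, orthogonalised against all earlier steps. -/
noncomputable def procedure (H₀ : E →ₗ.[ℂ] E) (V : E →L[ℂ] E) (E₀ : ℝ) :
    ℕ → Submodule ℂ E × Submodule ℂ E
  | 0 => (energySpace H₀ E₀, energySpace H₀ E₀)
  | n + 1 =>
    let K := (procedure H₀ V E₀ n).1
    let K' := (K ⊔ newStates H₀ V (procedure H₀ V E₀ n).2).topologicalClosure
    (K', K' ⊓ Kᗮ)

/-- The closed span of the states of step `n`. -/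
noncomputable def step (H₀ : E →ₗ.[ℂ] E) (V : E →L[ℂ] E) (E₀ : ℝ) (n : ℕ) : Submodule ℂ E :=
  (procedure H₀ V E₀ n).2

/-- The closed span of the states of steps `0, …, k`. -/
noncomputable def truncSpace (H₀ : E →ₗ.[ℂ] E) (V : E →L[ℂ] E) (E₀ : ℝ) (k : ℕ) :
    Submodule ℂ E :=
  (procedure H₀ V E₀ k).1

/-- The closed span of all the states generated by the procedure. -/
noncomputable def generated (H₀ : E →ₗ.[ℂ] E) (V : E →L[ℂ] E) (E₀ : ℝ) : Submodule ℂ E :=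
  (⨆ n, step H₀ V E₀ n).topologicalClosure

/-- The Hamiltonian truncated after step `k`: the compression of `H₀ + lam V` to the span of the
states of steps `0, …, k`. -/
noncomputable def truncHamiltonian (H₀ : E →ₗ.[ℂ] E) (V : E →L[ℂ] E) (E₀ : ℝ) (k : ℕ)
    (lam : ℝ) : E →ₗ.[ℂ] E where
  domain := H₀.domain ⊓ truncSpace H₀ V E₀ k
  toFun := (proj (truncSpace H₀ V E₀ k) : E →ₗ[ℂ] E) ∘ₗ (hamiltonian H₀ V lam).toFun ∘ₗ
    Submodule.inclusion inf_le_left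

end SCE

/-! The engine is a Feshbach–Schur reduction to W. Write P for the projection onto W and R(z) for
the sum of (e - z)⁻¹ P_e over the energies e ≠ E₀, which the gap bounds by 1/(d - r) for z in the
window. Then H(λ)x = zx splits into x + λR(z)Vx = Px and a remaining equation in W. For small λ the
first equation recovers x from Px as (1 + λR(z)V)⁻¹Px (`wave`), and the second says that Px is a
z-eigenvector of the finite-dimensional operator E₀ + λPV(1 + λR(z)V)⁻¹
(`IsReducedResolvent.energySpace_hamiltonian_eq`). By Weyl's inequality its sorted eigenvalues are
1/4-Lipschitz in z, and they stay near E₀, so each has exactly one fixed point; these N fixed points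
are the eigenvalues of H(λ) with multiplicity (`IsReducedResolvent.exists_levels`).

For the truncation, R(z) preserves every K_j because it is a function of H₀, while V maps K_j into
K_{j+1} (`apply_mem_truncSpace`). In the window the truncated Hamiltonian has the eigenspaces of H₀
+ λV', where V' is the compression of V to K_k. If t and s are the wave vectors of the same x in W
for V and V', the effective forms differ by λ⟨s, (V - V')t⟩ = λ⟨V(s - v), t - P_{K_k}t⟩ for every v
in K_k with Vv in K_k. Here t is within O(λ^{k+1}) of K_k, and v can be chosen within O(λ^k) of s.
The errors multiply, which gives the exponent 2k + 2 (`norm_inner_wave_sub_le`).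

The structural claims follow because the steps are mutually orthogonal, each is invariant under the
spectral projections of H₀, and V raises the step by at most one. The Taylor claim follows because
finitely many analytic functions keep a fixed order for small λ > 0. -/

namespace SCE

/-! ### Eigenvalue perturbation in finite dimension. -/

section Weyl

variable {F : Type*} [NormedAddCommGroup F] [InnerProductSpace ℂ F] [FiniteDimensional ℂ F]

lemma re_inner_eq_sum_eigenvalues {n : ℕ} (hn : Module.finrank ℂ F = n) {T : F →ₗ[ℂ] F}
    (hT : T.IsSymmetric) (x : F) :
    (inner ℂ x (T x)).re =
      ∑ j, hT.eigenvalues hn j * ‖inner ℂ (hT.eigenvectorBasis hn j) x‖ ^ 2 := by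
  rw [← (hT.eigenvectorBasis hn).sum_inner_mul_inner x (T x), Complex.re_sum]
  refine Finset.sum_congr rfl fun j _ => ?_
  rw [← hT, hT.apply_eigenvectorBasis, inner_smul_left, ← inner_conj_symm x, ← mul_assoc,
    mul_comm _ ((starRingEnd ℂ) _), mul_assoc, RCLike.conj_mul]
  simp [← Complex.ofReal_pow]

/-- Weyl's monotonicity inequality for the sorted eigenvalues of symmetric operators. -/
lemma eigenvalues_le_add {n : ℕ} (hn : Module.finrank ℂ F = n) {S T : F →ₗ[ℂ] F}
    (hS : S.IsSymmetric) (hT : T.IsSymmetric) {δ : ℝ}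
    (h : ∀ x, (inner ℂ x (T x)).re ≤ (inner ℂ x (S x)).re + δ * ‖x‖ ^ 2) (i : Fin n) :
    hT.eigenvalues hn i ≤ hS.eigenvalues hn i + δ := by
  set t := hT.eigenvectorBasis hn
  set s := hS.eigenvectorBasis hn
  -- Mathlib's eigenvalues decrease with the index. On `U` the form of `T` is at least its `i`-th
  -- eigenvalue, on `U'` the form of `S` is at most its `i`-th; the dimensions add up to `n + 1`, so
  -- a common nonzero vector exists.
  let U := Submodule.span ℂ (Set.range fun j : {j : Fin n // j ≤ i} => t j)
  let U' := Submodule.span ℂ (Set.range fun j : {j : Fin n // i ≤ j} => s j)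
  have hU : Module.finrank ℂ U = i + 1 := by
    refine (finrank_span_eq_card
      (t.orthonormal.linearIndependent.comp _ Subtype.val_injective)).trans ?_
    rw [Fintype.card_subtype, Finset.filter_ge_eq_Iic, Fin.card_Iic]
  have hU' : Module.finrank ℂ U' = n - i := by
    refine (finrank_span_eq_card
      (s.orthonormal.linearIndependent.comp _ Subtype.val_injective)).trans ?_
    rw [Fintype.card_subtype, Finset.filter_le_eq_Ici, Fin.card_Ici]
  have hne : U ⊓ U' ≠ ⊥ := by
    intro hbot
    have h1 := Submodule.finrank_sup_add_finrank_inf_eq U U'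
    rw [hbot, finrank_bot, hU, hU'] at h1
    have h2 := Submodule.finrank_le (U ⊔ U')
    have := i.2
    omega
  obtain ⟨x, ⟨hx, hx'⟩, hx0⟩ := Submodule.exists_mem_ne_zero_of_ne_bot hne
  have ht : ∀ j, ¬ j ≤ i → inner ℂ (t j) x = 0 := by
    intro j hj
    have : U ≤ (ℂ ∙ t j)ᗮ := by
      rw [Submodule.span_le]
      rintro _ ⟨k, rfl⟩
      rw [SetLike.mem_coe, Submodule.mem_orthogonal_singleton_iff_inner_right]
      exact t.orthonormal.2 fun h => hj (h ▸ k.2)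
    exact Submodule.mem_orthogonal_singleton_iff_inner_right.1 (this hx)
  have hs : ∀ j, ¬ i ≤ j → inner ℂ (s j) x = 0 := by
    intro j hj
    have : U' ≤ (ℂ ∙ s j)ᗮ := by
      rw [Submodule.span_le]
      rintro _ ⟨k, rfl⟩
      rw [SetLike.mem_coe, Submodule.mem_orthogonal_singleton_iff_inner_right]
      exact s.orthonormal.2 fun h => hj (h ▸ k.2)
    exact Submodule.mem_orthogonal_singleton_iff_inner_right.1 (this hx')
  have h1 : hT.eigenvalues hn i * ‖x‖ ^ 2 ≤ (inner ℂ x (T x)).re := by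
    rw [re_inner_eq_sum_eigenvalues hn hT, ← t.sum_sq_norm_inner_right x, Finset.mul_sum]
    refine Finset.sum_le_sum fun j _ => ?_
    by_cases hj : j ≤ i
    · exact mul_le_mul_of_nonneg_right (hT.eigenvalues_antitone hn hj) (sq_nonneg _)
    · simp [t, ht j hj]
  have h2 : (inner ℂ x (S x)).re ≤ hS.eigenvalues hn i * ‖x‖ ^ 2 := by
    rw [re_inner_eq_sum_eigenvalues hn hS, ← s.sum_sq_norm_inner_right x, Finset.mul_sum]
    refine Finset.sum_le_sum fun j _ => ?_
    by_cases hj : i ≤ j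
    · exact mul_le_mul_of_nonneg_right (hS.eigenvalues_antitone hn hj) (sq_nonneg _)
    · simp [s, hs j hj]
  have h3 := h x
  have hpos : 0 < ‖x‖ ^ 2 := by positivity
  refine le_of_mul_le_mul_right ?_ hpos
  linarith

open scoped Classical in
/-- The eigenvalues of a symmetric operator in increasing order. -/
noncomputable def sortedEig (T : F →ₗ[ℂ] F) (i : Fin (Module.finrank ℂ F)) : ℝ :=
  -- The constant default keeps the list monotone for every operator, so monotonicity in `i` is
  -- available even at parameters where symmetry is not known.
  if hT : T.IsSymmetric then hT.eigenvalues rfl i.rev else 0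

lemma sortedEig_monotone (T : F →ₗ[ℂ] F) : Monotone (sortedEig T) := by
  intro i j hij
  by_cases hT : T.IsSymmetric
  · simpa [sortedEig, hT] using hT.eigenvalues_antitone rfl (Fin.rev_le_rev.2 hij)
  · simp [sortedEig, hT]

lemma card_filter_sortedEig {T : F →ₗ[ℂ] F} (hT : T.IsSymmetric) (x : ℝ) :
    (Finset.univ.filter fun i => sortedEig T i = x).card =
      Module.finrank ℂ (Module.End.eigenspace T (x : ℂ)) := by
  rw [← hT.card_filter_eigenvalues_eq rfl]
  refine Finset.card_equiv Fin.revPerm fun i => ?_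
  simp [sortedEig, hT]

lemma abs_sortedEig_sub_le {S T : F →ₗ[ℂ] F} (hS : S.IsSymmetric) (hT : T.IsSymmetric) {δ : ℝ}
    (h : ∀ x, |(inner ℂ x (T x - S x)).re| ≤ δ * ‖x‖ ^ 2) (i : Fin (Module.finrank ℂ F)) :
    |sortedEig T i - sortedEig S i| ≤ δ := by
  simp only [sortedEig, hS, hT, dif_pos]
  have h1 := eigenvalues_le_add rfl hS hT (δ := δ) (fun x => by
    have := (abs_le.1 (h x)).2
    rw [inner_sub_right, Complex.sub_re] at this
    linarith) i.rev
  have h2 := eigenvalues_le_add rfl hT hS (δ := δ) (fun x => by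
    have := (abs_le.1 (h x)).1
    rw [inner_sub_right, Complex.sub_re] at this
    linarith) i.rev
  rw [abs_le]
  constructor <;> linarith

/-- Evaluate the form bound at an eigenvector. -/
lemma abs_sortedEig_sub_const_le {T : F →ₗ[ℂ] F} (hT : T.IsSymmetric) {c δ : ℝ}
    (h : ∀ x, |(inner ℂ x (T x - (c : ℂ) • x)).re| ≤ δ * ‖x‖ ^ 2)
    (i : Fin (Module.finrank ℂ F)) : |sortedEig T i - c| ≤ δ := by
  have hev : Module.End.HasEigenvalue T (sortedEig T i : ℂ) := by
    simp only [sortedEig, hT, dif_pos]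
    exact hT.hasEigenvalue_eigenvalues rfl i.rev
  obtain ⟨v, hv, hv0⟩ := hev.exists_hasEigenvector
  have h1 := h v
  rw [Module.End.mem_eigenspace_iff.1 hv, ← sub_smul, inner_smul_right,
    show inner ℂ v v = ((‖v‖ ^ 2 : ℝ) : ℂ) by rw [inner_self_eq_norm_sq_to_K]; norm_cast,
    ← Complex.ofReal_sub, ← Complex.ofReal_mul, Complex.ofReal_re, abs_mul] at h1
  have hpos : 0 < ‖v‖ ^ 2 := by positivity
  refine le_of_mul_le_mul_right ?_ hpos
  rwa [abs_of_pos hpos] at h1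

end Weyl

/-! ### Lists of eigenvalues with multiplicity. -/

section Lists

/-- A monotone finite list is determined by its multiplicities. -/
lemma eq_of_card_filter_eq {n : ℕ} {a b : Fin n → ℝ} (ha : Monotone a) (hb : Monotone b)
    (h : ∀ x, (Finset.univ.filter fun i => a i = x).card =
      (Finset.univ.filter fun i => b i = x).card) : a = b := by
  have hperm : (List.ofFn a).Perm (List.ofFn b) := by
    rw [← Multiset.coe_eq_coe, ← Fin.univ_val_map, ← Fin.univ_val_map]
    ext x
    rw [Multiset.count_map, Multiset.count_map]
    have := h x
    simp only [Finset.card_def, Finset.filter_val] at this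
    simpa only [eq_comm] using this
  have := hperm.eq_of_pairwise' ha.sortedLE_ofFn.pairwise hb.sortedLE_ofFn.pairwise
  exact List.ofFn_injective this

/-- Inside the window both counts are the dimension of the same eigenspace; outside it both vanish.
-/
lemma IsEnergyList.card_filter_eq {E : Type*} [NormedAddCommGroup E] [InnerProductSpace ℂ E]
    {A : E →ₗ.[ℂ] E} {e r : ℝ} {N : ℕ} {a b : Fin N → ℝ} (ha : IsEnergyList A e r a)
    (hb : IsEnergyList A e r b) (x : ℝ) :
    (Finset.univ.filter fun i => a i = x).card = (Finset.univ.filter fun i => b i = x).card := by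
  by_cases hx : |x - e| < r
  · exact_mod_cast (ha.2 x hx).symm.trans (hb.2 x hx)
  · rw [Finset.card_eq_zero.2, Finset.card_eq_zero.2] <;>
    · simp only [Finset.filter_eq_empty_iff, Finset.mem_univ, true_implies]
      rintro i rfl
      first | exact hx (ha.1 i) | exact hx (hb.1 i)

lemma IsEnergyList.comp_perm {E : Type*} [NormedAddCommGroup E] [InnerProductSpace ℂ E]
    {A : E →ₗ.[ℂ] E} {e r : ℝ} {N : ℕ} {a : Fin N → ℝ} (ha : IsEnergyList A e r a)
    (σ : Equiv.Perm (Fin N)) : IsEnergyList A e r (a ∘ σ) := by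
  refine ⟨fun i => ha.1 _, fun x hx => ?_⟩
  rw [ha.2 x hx]
  congr 1
  exact (Finset.card_equiv σ (by simp)).symm

lemma IsEnergyList.eq_of_monotone {E : Type*} [NormedAddCommGroup E] [InnerProductSpace ℂ E]
    {A : E →ₗ.[ℂ] E} {e r : ℝ} {N : ℕ} {a b : Fin N → ℝ} (ha : IsEnergyList A e r a)
    (hb : IsEnergyList A e r b) (hma : Monotone a) (hmb : Monotone b) : a = b :=
  eq_of_card_filter_eq hma hmb (ha.card_filter_eq hb)

lemma isEnergyList_congr {E : Type*} [NormedAddCommGroup E] [InnerProductSpace ℂ E]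
    {A B : E →ₗ.[ℂ] E} {e r : ℝ} {N : ℕ} {μ : Fin N → ℝ}
    (h : ∀ z, |z - e| < r → energySpace A z = energySpace B z) :
    IsEnergyList A e r μ ↔ IsEnergyList B e r μ := by
  refine and_congr_right fun _ => forall₂_congr fun z hz => ?_
  rw [h z hz]

end Lists

/-! ### One-sided asymptotics and ordering of analytic functions. -/

section Analytic

/-- If the vanishing order `p` were below `n`, then f = x^p g with g(0) ≠ 0, and dividing the bound
by x^p would force g(0) = 0. Approaching from the right is enough. -/
lemma iteratedDeriv_eq_zero_of_isBigO {f : ℝ → ℝ} (hf : AnalyticAt ℝ f 0) {n : ℕ}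
    (h : f =O[𝓝[>] 0] fun x => x ^ n) {m : ℕ} (hm : m < n) : iteratedDeriv m f 0 = 0 := by
  suffices hn : (n : ℕ∞) ≤ analyticOrderAt f 0 from
    (natCast_le_analyticOrderAt_iff_iteratedDeriv_eq_zero hf).1 hn m hm
  by_contra! hlt
  obtain ⟨p, hp⟩ := ENat.ne_top_iff_exists.1 hlt.ne_top
  obtain ⟨g, hg, hg0, hfg⟩ := hf.analyticOrderAt_eq_natCast.1 hp.symm
  rw [← hp, Nat.cast_lt] at hlt
  obtain ⟨C, hC⟩ := h.bound
  have hlim : Tendsto (fun x : ℝ => C * x ^ (n - p)) (𝓝[>] 0) (𝓝 0) := by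
    have : ContinuousAt (fun x : ℝ => C * x ^ (n - p)) 0 := by fun_prop
    have h2 := this.tendsto
    rw [zero_pow (by omega), mul_zero] at h2
    exact h2.mono_left nhdsWithin_le_nhds
  have hlim' : Tendsto (fun x => ‖g x‖) (𝓝[>] 0) (𝓝 ‖g 0‖) :=
    (hg.continuousAt.norm.tendsto).mono_left nhdsWithin_le_nhds
  have : ‖g 0‖ ≤ 0 := by
    refine le_of_tendsto_of_tendsto hlim' hlim ?_
    filter_upwards [hC, nhdsWithin_le_nhds hfg, self_mem_nhdsWithin] with x h1 h2 hx
    have hx : 0 < x := hx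
    rw [h2, sub_zero, smul_eq_mul, norm_mul, norm_pow, norm_pow, Real.norm_of_nonneg hx.le] at h1
    have hxp : 0 < x ^ p := by positivity
    refine le_of_mul_le_mul_left ?_ hxp
    calc x ^ p * ‖g x‖ ≤ C * x ^ n := h1
      _ = x ^ p * (C * x ^ (n - p)) := by
        rw [mul_left_comm, ← pow_add, Nat.add_sub_cancel' hlt.le]
  exact hg0 (norm_le_zero_iff.1 this)

/-- Unless f - g vanishes near 0, its sign for small x > 0 is that of its leading coefficient. -/
lemma eventually_le_or_eventually_gt_of_analyticAt {f g : ℝ → ℝ} (hf : AnalyticAt ℝ f 0)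
    (hg : AnalyticAt ℝ g 0) :
    (∀ᶠ x in 𝓝[>] 0, f x ≤ g x) ∨ ∀ᶠ x in 𝓝[>] 0, g x < f x := by
  have hh := hf.sub hg
  rcases eq_or_ne (analyticOrderAt (f - g) 0) ⊤ with htop | htop
  · left
    filter_upwards [nhdsWithin_le_nhds (analyticOrderAt_eq_top.1 htop)] with x hx
    have : f x - g x = 0 := hx
    linarith
  · obtain ⟨u, hu, hu0, hfu⟩ := hh.analyticOrderAt_ne_top.1 htop
    rcases lt_or_gt_of_ne hu0 with h | h
    · left
      filter_upwards [nhdsWithin_le_nhds hfu, self_mem_nhdsWithin,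
        nhdsWithin_le_nhds (hu.continuousAt.eventually_lt_const h)] with x h1 (h2 : 0 < x) h3
      have h4 : f x - g x = x ^ analyticOrderNatAt (f - g) 0 * u x := by simpa using h1
      have := mul_neg_of_pos_of_neg (pow_pos h2 (analyticOrderNatAt (f - g) 0)) h3
      linarith
    · right
      filter_upwards [nhdsWithin_le_nhds hfu, self_mem_nhdsWithin,
        nhdsWithin_le_nhds (hu.continuousAt.eventually_const_lt h)] with x h1 (h2 : 0 < x) h3
      have h4 : f x - g x = x ^ analyticOrderNatAt (f - g) 0 * u x := by simpa using h1
      have := mul_pos (pow_pos h2 (analyticOrderNatAt (f - g) 0)) h3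
      linarith

/-- Finitely many analytic functions can be sorted simultaneously on a right neighbourhood. -/
lemma exists_perm_eventually_monotone {n : ℕ} {f : Fin n → ℝ → ℝ}
    (hf : ∀ i, AnalyticAt ℝ (f i) 0) :
    ∃ σ : Equiv.Perm (Fin n), ∀ᶠ x in 𝓝[>] (0 : ℝ), Monotone fun i => f (σ i) x := by
  have h1 : ∀ᶠ y in 𝓝[>] (0 : ℝ), ∀ i j, f i y ≤ f j y →
      ∀ᶠ x in 𝓝[>] (0 : ℝ), f i x ≤ f j x := by
    simp only [eventually_all]
    intro i j
    rcases eventually_le_or_eventually_gt_of_analyticAt (hf i) (hf j) with h | h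
    · exact Eventually.of_forall fun _ _ => h
    · filter_upwards [h] with y hy hy' using absurd hy' hy.not_ge
  -- An inequality at this single point persists on a right neighbourhood of 0, so the permutation
  -- sorting the values at `y` sorts them throughout.
  obtain ⟨y, hy⟩ := h1.exists
  refine ⟨Tuple.sort fun i => f i y, ?_⟩
  have h2 : ∀ᶠ x in 𝓝[>] (0 : ℝ), ∀ i j, i ≤ j →
      f (Tuple.sort (fun i => f i y) i) x ≤ f (Tuple.sort (fun i => f i y) j) x := by
    simp only [eventually_all]
    exact fun i j hij => hy _ _ (Tuple.monotone_sort (fun i => f i y) hij)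
  filter_upwards [h2] with x hx i j hij using hx i j hij

/-- Analytic enumerations of energies whose sorted enumerations agree up to order `n` have, after a
permutation, the same Taylor coefficients below order `n`. -/
lemma exists_perm_iteratedDeriv_eq {E : Type*} [NormedAddCommGroup E]
    [InnerProductSpace ℂ E] {E₀ r : ℝ} {A B : ℝ → E →ₗ.[ℂ] E} {N n : ℕ} {μ ν : ℝ → Fin N → ℝ}
    (hμ : ∀ᶠ lam in 𝓝 0, Monotone (μ lam) ∧ IsEnergyList (A lam) E₀ r (μ lam))
    (hν : ∀ᶠ lam in 𝓝 0, Monotone (ν lam) ∧ IsEnergyList (B lam) E₀ r (ν lam))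
    (hO : ∀ i, (fun lam => μ lam i - ν lam i) =O[𝓝 0] (fun lam : ℝ => lam ^ n))
    {f g : Fin N → ℝ → ℝ} (hf : ∀ i, AnalyticAt ℝ (f i) 0) (hg : ∀ i, AnalyticAt ℝ (g i) 0)
    (hfA : ∀ᶠ lam in 𝓝 0, IsEnergyList (A lam) E₀ r fun i => f i lam)
    (hgB : ∀ᶠ lam in 𝓝 0, IsEnergyList (B lam) E₀ r fun i => g i lam) :
    ∃ σ : Equiv.Perm (Fin N),
      ∀ i, ∀ m < n, iteratedDeriv m (f i) 0 = iteratedDeriv m (g (σ i)) 0 := by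
  obtain ⟨σ, hσ⟩ := exists_perm_eventually_monotone hf
  obtain ⟨τ, hτ⟩ := exists_perm_eventually_monotone hg
  -- For small λ > 0, `f (σ j)` and `g (τ j)` are both the `j`-th smallest value of their list. The
  -- branches may cross at 0, so only the right side is compared.
  refine ⟨σ.symm.trans τ, fun i m hm => ?_⟩
  have hfg := (hf i).sub (hg (τ (σ.symm i)))
  have h0 : (f i - g (τ (σ.symm i))) =O[𝓝[>] 0] fun x => x ^ n := by
    refine IsBigO.congr' ((hO (σ.symm i)).mono nhdsWithin_le_nhds) ?_ EventuallyEq.rfl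
    filter_upwards [hσ, hτ, nhdsWithin_le_nhds hμ, nhdsWithin_le_nhds hν, nhdsWithin_le_nhds hfA,
      nhdsWithin_le_nhds hgB] with lam h1 h2 h3 h4 h5 h6
    have e1 := congrFun (h3.2.eq_of_monotone (h5.comp_perm σ) h3.1 h1) (σ.symm i)
    have e2 := congrFun (h4.2.eq_of_monotone (h6.comp_perm τ) h4.1 h2) (σ.symm i)
    rw [e1, e2]
    simp
  have h1 := iteratedDeriv_eq_zero_of_isBigO hfg h0 hm
  rw [iteratedDeriv_sub (hf i).contDiffAt (hg _).contDiffAt] at h1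
  exact sub_eq_zero.1 h1

end Analytic

/-! ### Projections onto closures. -/

section Proj

variable {E : Type*} [NormedAddCommGroup E] [InnerProductSpace ℂ E] [CompleteSpace E]
  (K : Submodule ℂ E)

lemma inner_proj_left (x y : E) : inner ℂ (proj K x) y = inner ℂ x (proj K y) :=
  Submodule.inner_starProjection_left_eq_right _ _ _

lemma norm_proj_apply_le (x : E) : ‖proj K x‖ ≤ ‖x‖ :=
  Submodule.norm_starProjection_apply_le _ _

variable {K}

lemma proj_of_mem {x : E} (hx : x ∈ K) : proj K x = x :=
  Submodule.starProjection_eq_self_iff.2 (K.le_topologicalClosure hx)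

lemma proj_mem (hK : IsClosed (K : Set E)) (x : E) : proj K x ∈ K :=
  hK.submodule_topologicalClosure_eq.le (Submodule.starProjection_apply_mem _ x)

lemma proj_eq_zero_iff {x : E} : proj K x = 0 ↔ x ∈ Kᗮ := by
  rw [proj, Submodule.starProjection_apply_eq_zero_iff, Submodule.orthogonal_closure]

lemma sub_proj_mem_orthogonal (x : E) : x - proj K x ∈ Kᗮ := by
  have := Submodule.sub_starProjection_mem_orthogonal (K := K.topologicalClosure) x
  rwa [Submodule.orthogonal_closure] at this

end Proj

/-! ### Eigenspaces of the unperturbed operator and its reducing subspaces. -/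

section EnergySpace

variable {E : Type*} [NormedAddCommGroup E] [InnerProductSpace ℂ E]

lemma mem_energySpace {A : E →ₗ.[ℂ] E} {e : ℝ} {x : E} :
    x ∈ energySpace A e ↔ ∃ hx : x ∈ A.domain, A ⟨x, hx⟩ = (e : ℂ) • x := by
  simp only [energySpace, Submodule.mem_map, LinearMap.mem_ker, LinearMap.sub_apply,
    LinearMap.smul_apply, Submodule.subtype_apply, sub_eq_zero]
  constructor
  · rintro ⟨y, hy, rfl⟩
    exact ⟨y.2, hy⟩
  · rintro ⟨hx, h⟩
    exact ⟨⟨x, hx⟩, h, rfl⟩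

variable [CompleteSpace E] {H₀ : E →ₗ.[ℂ] E}

lemma inner_apply_left (hH₀ : IsSelfAdjoint H₀) (x y : H₀.domain) :
    inner ℂ (H₀ x) (y : E) = inner ℂ (x : E) (H₀ y) := by
  have h := LinearPMap.adjoint_isFormalAdjoint hH₀.dense_domain
  rw [LinearPMap.isSelfAdjoint_def.1 hH₀] at h
  exact h x y

/-- Self-adjointness, not mere symmetry: the weak equation already puts `x` in the domain of the
adjoint, which is the domain of `H₀`. -/
lemma exists_apply_eq_iff (hH₀ : IsSelfAdjoint H₀) {x z : E} :
    (∃ hx : x ∈ H₀.domain, H₀ ⟨x, hx⟩ = z) ↔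
      ∀ y : H₀.domain, inner ℂ z (y : E) = inner ℂ x (H₀ y) := by
  constructor
  · rintro ⟨hx, rfl⟩ y
    exact inner_apply_left hH₀ ⟨x, hx⟩ y
  · intro h
    have hx : x ∈ H₀.domain := by
      have := LinearPMap.mem_adjoint_domain_of_exists (T := H₀) x ⟨z, h⟩
      rwa [LinearPMap.isSelfAdjoint_def.1 hH₀] at this
    refine ⟨hx, hH₀.dense_domain.eq_of_inner_left ℂ fun v hv => ?_⟩
    exact (inner_apply_left hH₀ ⟨x, hx⟩ ⟨v, hv⟩).trans (h ⟨v, hv⟩).symm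

lemma mem_energySpace_iff_inner (hH₀ : IsSelfAdjoint H₀) {e : ℝ} {x : E} :
    x ∈ energySpace H₀ e ↔ ∀ y : H₀.domain, inner ℂ x ((e : ℂ) • (y : E) - H₀ y) = 0 := by
  rw [mem_energySpace, exists_apply_eq_iff hH₀]
  refine forall_congr' fun y => ?_
  rw [inner_sub_right, sub_eq_zero, inner_smul_left, inner_smul_right, Complex.conj_ofReal]

lemma isClosed_energySpace (hH₀ : IsSelfAdjoint H₀) (e : ℝ) :
    IsClosed (energySpace H₀ e : Set E) := by
  have : (energySpace H₀ e : Set E) =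
      ⋂ y : H₀.domain, {x | inner ℂ x ((e : ℂ) • (y : E) - H₀ y) = 0} := by
    ext x
    simp only [SetLike.mem_coe, mem_energySpace_iff_inner hH₀, Set.mem_iInter, Set.mem_ofPred_eq]
  rw [this]
  exact isClosed_iInter fun y => isClosed_eq (by fun_prop) continuous_const

lemma inner_eq_zero_of_mem_energySpace (hH₀ : IsSelfAdjoint H₀) {e f : ℝ} (hef : e ≠ f) {x y : E}
    (hx : x ∈ energySpace H₀ e) (hy : y ∈ energySpace H₀ f) : inner ℂ x y = 0 := by
  obtain ⟨hyd, hy⟩ := mem_energySpace.1 hy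
  have h := (mem_energySpace_iff_inner hH₀).1 hx ⟨y, hyd⟩
  rw [hy, ← sub_smul, inner_smul_right, ← Complex.ofReal_sub] at h
  exact (mul_eq_zero.1 h).resolve_left (by exact_mod_cast sub_ne_zero.2 hef)

lemma proj_energySpace_of_ne (hH₀ : IsSelfAdjoint H₀) {e f : ℝ} (hef : e ≠ f) {x : E}
    (hx : x ∈ energySpace H₀ f) : proj (energySpace H₀ e) x = 0 :=
  proj_eq_zero_iff.2 fun _ hy => inner_eq_zero_of_mem_energySpace hH₀ hef hy hx

/-- A vector whose components of definite energy all vanish is zero. -/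
lemma eq_zero_of_forall_proj_eq_zero
    (hbasis : (⨆ e : ℝ, energySpace H₀ e).topologicalClosure = ⊤) {x : E}
    (h : ∀ e, proj (energySpace H₀ e) x = 0) : x = 0 := by
  have h1 : x ∈ (⨆ e : ℝ, energySpace H₀ e)ᗮ := by
    rw [← Submodule.iInf_orthogonal, Submodule.mem_iInf]
    exact fun e => proj_eq_zero_iff.1 (h e)
  rwa [← Submodule.orthogonal_closure, hbasis, Submodule.top_orthogonal_eq_bot,
    Submodule.mem_bot] at h1

/-- A closed subspace contains every vector whose components of definite energy it contains. -/
lemma mem_of_forall_proj_mem (hH₀ : IsSelfAdjoint H₀)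
    (hbasis : (⨆ e : ℝ, energySpace H₀ e).topologicalClosure = ⊤) {K : Submodule ℂ E}
    (hK : IsClosed (K : Set E)) {x : E} (h : ∀ e, proj (energySpace H₀ e) x ∈ K) : x ∈ K := by
  have hcl := isClosed_energySpace hH₀
  -- `K` need not be invariant under the spectral projections, so `x` is shown to lie in the closed
  -- span `L` of its own components. For this, y = x - P_L x is tested on an energy-`e` vector `u`,
  -- split into its part along p = P_e x and a part u' orthogonal to `p`. The first is in `L`; the
  -- second is orthogonal to both `x` and `L`.
  let L := (Submodule.span ℂ (Set.range fun e => proj (energySpace H₀ e) x)).topologicalClosure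
  have hLK : L ≤ K := Submodule.topologicalClosure_minimal _
    (Submodule.span_le.2 (by rintro _ ⟨e, rfl⟩; exact h e)) hK
  have hL : IsClosed (L : Set E) := Submodule.isClosed_topologicalClosure _
  have hmem : ∀ e, proj (energySpace H₀ e) x ∈ L := fun e =>
    Submodule.le_topologicalClosure _ (Submodule.subset_span ⟨e, rfl⟩)
  suffices hx : x - proj L x = 0 by
    rw [sub_eq_zero.1 hx]
    exact hLK (proj_mem hL x)
  refine eq_zero_of_forall_proj_eq_zero hbasis fun e => proj_eq_zero_iff.2 fun u hu => ?_
  set p := proj (energySpace H₀ e) x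
  set y := x - proj L x
  have hy : y ∈ Lᗮ := sub_proj_mem_orthogonal x
  obtain ⟨a, ha⟩ := Submodule.mem_span_singleton.1 (Submodule.starProjection_apply_mem (ℂ ∙ p) u)
  set u' := u - (ℂ ∙ p).starProjection u with hu'
  have hu'p : inner ℂ p u' = 0 := Submodule.mem_orthogonal_singleton_iff_inner_right.1
    (Submodule.sub_starProjection_mem_orthogonal u)
  have hp : p ∈ energySpace H₀ e := proj_mem (hcl e) x
  have hu'e : u' ∈ energySpace H₀ e := by
    rw [hu', ← ha]
    exact Submodule.sub_mem _ hu (Submodule.smul_mem _ _ hp)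
  have hu'L : L ≤ (ℂ ∙ u')ᗮ := by
    refine Submodule.topologicalClosure_minimal _ (Submodule.span_le.2 ?_)
      (Submodule.isClosed_orthogonal _)
    rintro _ ⟨f, rfl⟩
    rw [SetLike.mem_coe, Submodule.mem_orthogonal_singleton_iff_inner_left]
    rcases eq_or_ne f e with rfl | hf
    · exact hu'p
    · exact inner_eq_zero_of_mem_energySpace hH₀ hf (proj_mem (hcl f) x) hu'e
  have h1 : inner ℂ u' x = 0 := by
    rw [← proj_of_mem hu'e, inner_proj_left, ← inner_conj_symm, hu'p, map_zero]
  have h2 : inner ℂ u' (proj L x) = 0 :=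
    Submodule.mem_orthogonal_singleton_iff_inner_right.1 (hu'L (proj_mem hL x))
  have h3 : inner ℂ p y = 0 := hy _ (hmem e)
  have h4 : u = a • p + u' := by rw [ha, hu']; abel
  rw [h4, inner_add_left, inner_smul_left, h3, inner_sub_right, h1, h2]
  simp

/-- A closed subspace that contains with each vector its components of definite energy. -/
structure IsReducing (H₀ : E →ₗ.[ℂ] E) (K : Submodule ℂ E) : Prop where
  isClosed : IsClosed (K : Set E)
  proj_mem : ∀ e, ∀ x ∈ K, proj (energySpace H₀ e) x ∈ K

lemma IsReducing.top : IsReducing H₀ ⊤ := ⟨isClosed_univ, fun _ _ _ => trivial⟩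

lemma IsReducing.inf {K L : Submodule ℂ E} (hK : IsReducing H₀ K) (hL : IsReducing H₀ L) :
    IsReducing H₀ (K ⊓ L) :=
  ⟨hK.isClosed.inter hL.isClosed, fun e x hx => ⟨hK.proj_mem e x hx.1, hL.proj_mem e x hx.2⟩⟩

lemma IsReducing.orthogonal {K : Submodule ℂ E} (hK : IsReducing H₀ K) : IsReducing H₀ Kᗮ :=
  ⟨Submodule.isClosed_orthogonal _, fun e x hx y hy => by
    rw [← inner_proj_left]
    exact hx _ (hK.proj_mem e y hy)⟩

lemma isReducing_topologicalClosure {K : Submodule ℂ E}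
    (hK : ∀ e, ∀ x ∈ K, proj (energySpace H₀ e) x ∈ K) : IsReducing H₀ K.topologicalClosure :=
  ⟨Submodule.isClosed_topologicalClosure _, fun e => by
    have : K.topologicalClosure ≤
        K.topologicalClosure.comap (proj (energySpace H₀ e) : E →ₗ[ℂ] E) :=
      Submodule.topologicalClosure_minimal _
        (fun x hx => Submodule.le_topologicalClosure _ (hK e x hx))
        ((Submodule.isClosed_topologicalClosure K).preimage (proj (energySpace H₀ e)).continuous)
    exact this⟩

lemma isReducing_energySpace (hH₀ : IsSelfAdjoint H₀) (e : ℝ) :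
    IsReducing H₀ (energySpace H₀ e) :=
  ⟨isClosed_energySpace hH₀ e, fun f x hx => by
    rcases eq_or_ne f e with rfl | hf
    · rwa [proj_of_mem hx]
    · rw [proj_energySpace_of_ne hH₀ hf hx]
      exact Submodule.zero_mem _⟩

/-- A reducing subspace has an orthonormal basis of eigenvectors. -/
lemma IsReducing.exists_orthonormal (hH₀ : IsSelfAdjoint H₀)
    (hbasis : (⨆ e : ℝ, energySpace H₀ e).topologicalClosure = ⊤) {K : Submodule ℂ E}
    (hK : IsReducing H₀ K) :
    ∃ B : Set E, Orthonormal ℂ (fun x : B => (x : E)) ∧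
      (Submodule.span ℂ B).topologicalClosure = K ∧ ∀ x ∈ B, ∃ e : ℝ, x ∈ energySpace H₀ e := by
  have hcl : ∀ e, IsClosed ((K ⊓ energySpace H₀ e : Submodule ℂ E) : Set E) := fun e =>
    (hK.inf (isReducing_energySpace hH₀ e)).isClosed
  -- Bases are chosen separately in each energy sector of `K`; distinct sectors are orthogonal, so
  -- the union is orthonormal.
  have : ∀ e, ∃ w : Set E, Orthonormal ℂ (fun x : w => (x : E)) ∧
      (Submodule.span ℂ w).topologicalClosure = K ⊓ energySpace H₀ e := by
    intro e
    have := (hcl e).completeSpace_coe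
    obtain ⟨w, b, hb⟩ := exists_hilbertBasis ℂ (K ⊓ energySpace H₀ e : Submodule ℂ E)
    have ho := b.orthonormal
    rw [hb] at ho
    refine ⟨Subtype.val '' w, ?_, le_antisymm ?_ ?_⟩
    · have := (ho.comp_linearIsometry
        (K ⊓ energySpace H₀ e : Submodule ℂ E).subtypeₗᵢ).toSubtypeRange
      have hr : Set.range (((K ⊓ energySpace H₀ e : Submodule ℂ E).subtypeₗᵢ) ∘
          (Subtype.val : w → _)) = Subtype.val '' w := by
        rw [Set.range_comp, Subtype.range_coe]; rfl
      rwa [hr] at this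
    · refine Submodule.topologicalClosure_minimal _ (Submodule.span_le.2 ?_) (hcl e)
      rintro _ ⟨x, -, rfl⟩
      exact x.2
    · intro x hx
      have h1 : (⟨x, hx⟩ : (K ⊓ energySpace H₀ e : Submodule ℂ E)) ∈
          (Submodule.span ℂ w).topologicalClosure := by
        have := b.dense_span
        rw [hb, Subtype.range_coe] at this
        rw [this]; trivial
      have h2 := (Submodule.span ℂ w).topologicalClosure_map
        ((K ⊓ energySpace H₀ e : Submodule ℂ E).subtypeL)
      have h3 := h2 (Submodule.mem_map_of_mem h1)
      rw [Submodule.map_span] at h3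
      exact h3
  choose w hw hspan using this
  have hmem : ∀ e, ∀ x ∈ w e, x ∈ K ⊓ energySpace H₀ e := fun e x hx => by
    rw [← hspan]
    exact Submodule.le_topologicalClosure _ (Submodule.subset_span hx)
  refine ⟨⋃ e, w e, ⟨?_, ?_⟩, le_antisymm ?_ ?_, ?_⟩
  · rintro ⟨x, hx⟩
    obtain ⟨e, he⟩ := Set.mem_iUnion.1 hx
    exact (hw e).1 ⟨x, he⟩
  · rintro ⟨x, hx⟩ ⟨y, hy⟩ hxy
    obtain ⟨e, he⟩ := Set.mem_iUnion.1 hx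
    obtain ⟨f, hf⟩ := Set.mem_iUnion.1 hy
    rcases eq_or_ne e f with rfl | hef
    · exact (hw e).2 (i := ⟨x, he⟩) (j := ⟨y, hf⟩) (by simpa using hxy)
    · exact inner_eq_zero_of_mem_energySpace hH₀ hef (hmem e x he).2 (hmem f y hf).2
  · refine Submodule.topologicalClosure_minimal _ (Submodule.span_le.2 ?_) hK.isClosed
    intro x hx
    obtain ⟨e, he⟩ := Set.mem_iUnion.1 hx
    exact (hmem e x he).1
  · intro x hx
    refine mem_of_forall_proj_mem hH₀ hbasis (Submodule.isClosed_topologicalClosure _) fun e => ?_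
    have h1 : proj (energySpace H₀ e) x ∈ K ⊓ energySpace H₀ e :=
      ⟨hK.proj_mem e x hx, SCE.proj_mem (isClosed_energySpace hH₀ e) x⟩
    rw [← hspan] at h1
    exact Submodule.topologicalClosure_mono (Submodule.span_mono (Set.subset_iUnion w e)) h1
  · intro x hx
    obtain ⟨e, he⟩ := Set.mem_iUnion.1 hx
    exact ⟨e, (hmem e x he).2⟩

end EnergySpace

/-! ### Diagonalisation and the reduced resolvent. -/

section EigenBasis

variable {E : Type*} [NormedAddCommGroup E] [InnerProductSpace ℂ E]

/-- A Hilbert basis of eigenvectors of `H₀`, with their energies. -/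
structure EigenBasis (H₀ : E →ₗ.[ℂ] E) (ι : Type*) where
  basis : HilbertBasis ι ℂ E
  energy : ι → ℝ
  mem : ∀ i, basis i ∈ energySpace H₀ (energy i)

lemma ext_inner_basis {ι : Type*} (b : HilbertBasis ι ℂ E) {x y : E}
    (h : ∀ i, inner ℂ (b i) x = inner ℂ (b i) y) : x = y := by
  refine b.repr.injective (lp.ext (funext fun i => ?_))
  rw [b.repr_apply_apply, b.repr_apply_apply, h]

/-- Bounded diagonal operators with respect to a Hilbert basis. -/
lemma exists_diagonal {ι : Type*} (b : HilbertBasis ι ℂ E) (c : ι → ℂ) {C : ℝ} (hC : 0 ≤ C)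
    (hc : ∀ i, ‖c i‖ ≤ C) :
    ∃ R : E →L[ℂ] E, ‖R‖ ≤ C ∧ ∀ i x, inner ℂ (b i) (R x) = c i * inner ℂ (b i) x := by
  have hT : ∀ i, ‖c i • ContinuousLinearMap.id ℂ ℂ‖ ≤ C := fun i => by
    rw [norm_smul, ContinuousLinearMap.norm_id, mul_one]
    exact hc i
  let D := lp.mapCLM 2 (fun i => c i • ContinuousLinearMap.id ℂ ℂ) hC hT
  refine ⟨(b.repr.symm.toContinuousLinearEquiv : _ →L[ℂ] E) ∘L D ∘L
    (b.repr.toContinuousLinearEquiv : E →L[ℂ] _), ?_, fun i x => ?_⟩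
  · refine ContinuousLinearMap.opNorm_le_bound _ hC fun x => ?_
    have : ‖D (b.repr x)‖ ≤ C * ‖b.repr x‖ :=
      D.le_of_opNorm_le (lp.norm_mapCLM_le 2 _ hC hT) _
    simpa using this
  · rw [← b.repr_apply_apply, ← b.repr_apply_apply]
    simp [D]

variable [CompleteSpace E] {H₀ : E →ₗ.[ℂ] E}

lemma exists_eigenBasis (hH₀ : IsSelfAdjoint H₀)
    (hbasis : (⨆ e : ℝ, energySpace H₀ e).topologicalClosure = ⊤) :
    ∃ B : Set E, Nonempty (EigenBasis H₀ B) := by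
  obtain ⟨B, ho, hspan, hB⟩ := (IsReducing.top (H₀ := H₀)).exists_orthonormal hH₀ hbasis
  choose e he using hB
  have hsp : ⊤ ≤ (Submodule.span ℂ (Set.range fun x : B => (x : E))).topologicalClosure := by
    rw [Subtype.range_coe, hspan]
  refine ⟨B, ⟨⟨HilbertBasis.mk ho hsp, fun x => e x x.2, fun x => ?_⟩⟩⟩
  rw [HilbertBasis.coe_mk]
  exact he x x.2

namespace EigenBasis

variable {ι : Type*} (b : EigenBasis H₀ ι)

/-- `H₀` is the maximal multiplication operator by the energies: Parseval turns the coordinate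
equations into the weak equation, which includes membership in the domain. -/
lemma exists_apply_eq_iff (hH₀ : IsSelfAdjoint H₀) {x z : E} :
    (∃ hx : x ∈ H₀.domain, H₀ ⟨x, hx⟩ = z) ↔
      ∀ i, inner ℂ (b.basis i) z = b.energy i * inner ℂ (b.basis i) x := by
  have key : ∀ i, ∀ y : H₀.domain,
      inner ℂ (b.basis i) (H₀ y) = b.energy i * inner ℂ (b.basis i) (y : E) := fun i y => by
    have := (mem_energySpace_iff_inner hH₀).1 (b.mem i) y
    rw [inner_sub_right, inner_smul_right, sub_eq_zero] at this
    exact this.symm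
  constructor
  · rintro ⟨hx, rfl⟩ i
    exact key i ⟨x, hx⟩
  · intro h
    rw [SCE.exists_apply_eq_iff hH₀]
    intro y
    rw [← b.basis.tsum_inner_mul_inner z, ← b.basis.tsum_inner_mul_inner x]
    refine tsum_congr fun i => ?_
    rw [key, ← inner_conj_symm z, h i, map_mul, Complex.conj_ofReal, inner_conj_symm]
    ring

lemma inner_proj_energySpace (hH₀ : IsSelfAdjoint H₀) (i : ι) (e : ℝ) (x : E) :
    inner ℂ (b.basis i) (proj (energySpace H₀ e) x) =
      if b.energy i = e then inner ℂ (b.basis i) x else 0 := by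
  rw [← inner_proj_left]
  split_ifs with h
  · rw [proj_of_mem (h ▸ b.mem i)]
  · rw [proj_energySpace_of_ne hH₀ (Ne.symm h) (b.mem i), inner_zero_left]

/-- A diagonal operator whose entries depend only on the energy preserves reducing subspaces. -/
lemma apply_mem_of_isReducing (hH₀ : IsSelfAdjoint H₀)
    (hbasis : (⨆ e : ℝ, energySpace H₀ e).topologicalClosure = ⊤) {R : E →L[ℂ] E} {c : ℝ → ℂ}
    (hR : ∀ i x, inner ℂ (b.basis i) (R x) = c (b.energy i) * inner ℂ (b.basis i) x)
    {K : Submodule ℂ E} (hK : IsReducing H₀ K) {x : E} (hx : x ∈ K) : R x ∈ K := by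
  refine mem_of_forall_proj_mem hH₀ hbasis hK.isClosed fun e => ?_
  have : proj (energySpace H₀ e) (R x) = c e • proj (energySpace H₀ e) x := by
    refine ext_inner_basis b.basis fun i => ?_
    rw [inner_smul_right, b.inner_proj_energySpace hH₀, b.inner_proj_energySpace hH₀, hR]
    split_ifs with h
    · rw [h]
    · rw [mul_zero]
  rw [this]
  exact K.smul_mem _ (hK.proj_mem e x hx)

end EigenBasis

/-- Both `K` and its orthogonal complement are invariant under the spectral projection. -/
lemma IsReducing.proj_comm {K : Submodule ℂ E} (hK : IsReducing H₀ K) (e : ℝ) (x : E) :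
    proj K (proj (energySpace H₀ e) x) = proj (energySpace H₀ e) (proj K x) := by
  have h1 : proj (energySpace H₀ e) (x - proj K x) ∈ Kᗮ :=
    hK.orthogonal.proj_mem e _ (sub_proj_mem_orthogonal x)
  have h2 := hK.proj_mem e _ (SCE.proj_mem hK.isClosed x)
  rw [map_sub] at h1
  have h3 := proj_eq_zero_iff.2 h1
  rwa [map_sub, proj_of_mem h2, sub_eq_zero] at h3

/-- A reducing subspace reduces `H₀` as an unbounded operator. -/
lemma IsReducing.exists_proj_apply (hH₀ : IsSelfAdjoint H₀)
    (hbasis : (⨆ e : ℝ, energySpace H₀ e).topologicalClosure = ⊤) {K : Submodule ℂ E}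
    (hK : IsReducing H₀ K) (x : H₀.domain) :
    ∃ hx : proj K (x : E) ∈ H₀.domain, H₀ ⟨_, hx⟩ = proj K (H₀ x) := by
  obtain ⟨B, ⟨b⟩⟩ := exists_eigenBasis hH₀ hbasis
  rw [b.exists_apply_eq_iff hH₀]
  intro i
  rw [← inner_proj_left, ← inner_proj_left]
  have h1 : proj K (b.basis i) ∈ energySpace H₀ (b.energy i) := by
    rw [← proj_of_mem (b.mem i), hK.proj_comm]
    exact SCE.proj_mem (isClosed_energySpace hH₀ _) _
  have := (mem_energySpace_iff_inner hH₀).1 h1 x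
  rw [inner_sub_right, inner_smul_right, sub_eq_zero] at this
  exact this.symm

lemma IsReducing.apply_mem (hH₀ : IsSelfAdjoint H₀)
    (hbasis : (⨆ e : ℝ, energySpace H₀ e).topologicalClosure = ⊤) {K : Submodule ℂ E}
    (hK : IsReducing H₀ K) (x : H₀.domain) (hx : (x : E) ∈ K) : H₀ x ∈ K := by
  obtain ⟨h, h'⟩ := hK.exists_proj_apply hH₀ hbasis x
  have : (⟨_, h⟩ : H₀.domain) = x := Subtype.ext (proj_of_mem hx)
  rw [← this, h']
  exact SCE.proj_mem hK.isClosed _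

/-- The reduced resolvent of `H₀` near an isolated energy `E₀`. -/
structure IsReducedResolvent (H₀ : E →ₗ.[ℂ] E) (E₀ r c : ℝ) (R : ℝ → E →L[ℂ] E) : Prop where
  isSelfAdjoint : ∀ z, |z - E₀| < r → IsSelfAdjoint (R z)
  norm_le : ∀ z, |z - E₀| < r → ‖R z‖ ≤ c
  norm_sub_le : ∀ z w, |z - E₀| < r → |w - E₀| < r → ‖R z - R w‖ ≤ c ^ 2 * |z - w|
  proj_apply : ∀ z, |z - E₀| < r → ∀ x, proj (energySpace H₀ E₀) (R z x) = 0
  apply_mem : ∀ z, |z - E₀| < r → ∀ K, IsReducing H₀ K → ∀ x ∈ K, R z x ∈ K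
  -- The equation (H₀ - z)x = -y, sector by sector: away from `E₀` it is solved by `R z`, and at
  -- `E₀` it leaves a scalar equation in the eigenspace.
  exists_apply_eq_iff : ∀ z, |z - E₀| < r → ∀ x y : E,
    (∃ hx : x ∈ H₀.domain, H₀ ⟨x, hx⟩ = (z : ℂ) • x - y) ↔
      x + R z y = proj (energySpace H₀ E₀) x ∧
        ((E₀ - z : ℝ) : ℂ) • proj (energySpace H₀ E₀) x + proj (energySpace H₀ E₀) y = 0

lemma exists_isReducedResolvent (hH₀ : IsSelfAdjoint H₀)
    (hbasis : (⨆ e : ℝ, energySpace H₀ e).topologicalClosure = ⊤) {E₀ d r : ℝ}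
    (hgap : ∀ e : ℝ, e ≠ E₀ → energySpace H₀ e ≠ ⊥ → d ≤ |e - E₀|) (hrd : r < d) :
    ∃ R : ℝ → E →L[ℂ] E, IsReducedResolvent H₀ E₀ r (d - r)⁻¹ R := by
  obtain ⟨B, ⟨b⟩⟩ := exists_eigenBasis hH₀ hbasis
  have hc : 0 ≤ (d - r)⁻¹ := inv_nonneg.2 (by linarith)
  have hne : ∀ z, |z - E₀| < r → ∀ i, b.energy i ≠ E₀ → d - r ≤ |b.energy i - z| := by
    intro z hz i hi
    have h1 := hgap _ hi fun h => by
      have := b.mem i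
      rw [h, Submodule.mem_bot] at this
      exact b.basis.orthonormal.ne_zero i this
    have := abs_sub_le (b.energy i) z E₀
    linarith
  -- The singular sector is removed, so z = E₀ is allowed; elsewhere |e - z| ≥ d - r.
  let c : ℝ → ℝ → ℂ := fun z e => if e = E₀ then 0 else ((e - z)⁻¹ : ℝ)
  have hex : ∀ z, ∃ R : E →L[ℂ] E, |z - E₀| < r → ‖R‖ ≤ (d - r)⁻¹ ∧
      ∀ i x, inner ℂ (b.basis i) (R x) = c z (b.energy i) * inner ℂ (b.basis i) x := by
    intro z
    by_cases hz : |z - E₀| < r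
    · obtain ⟨R, hR⟩ := exists_diagonal b.basis (fun i => c z (b.energy i)) hc fun i => by
        simp only [c]
        split_ifs with h
        · simpa using hc
        · rw [Complex.norm_real, norm_inv, Real.norm_eq_abs]
          exact inv_anti₀ (by linarith) (hne z hz i h)
      exact ⟨R, fun _ => hR⟩
    · exact ⟨0, fun h => absurd h hz⟩
  choose R hR using hex
  refine ⟨R, ?_, fun z hz => (hR z hz).1, ?_, ?_, ?_, ?_⟩
  · intro z hz
    rw [ContinuousLinearMap.isSelfAdjoint_iff_isSymmetric]
    intro x y
    simp only [ContinuousLinearMap.coe_coe]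
    rw [← b.basis.tsum_inner_mul_inner, ← b.basis.tsum_inner_mul_inner]
    refine tsum_congr fun i => ?_
    rw [← inner_conj_symm, (hR z hz).2, (hR z hz).2, map_mul, inner_conj_symm]
    have : (starRingEnd ℂ) (c z (b.energy i)) = c z (b.energy i) := by
      simp only [c]
      split_ifs
      · simp
      · exact Complex.conj_ofReal _
    rw [this]
    ring
  · intro z w hz hw
    -- First resolvent identity, which survives the removal of one sector and gives the Lipschitz
    -- constant.
    have : R z - R w = ((z - w : ℝ) : ℂ) • (R z ∘L R w) := by
      ext x
      refine ext_inner_basis b.basis fun i => ?_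
      rw [sub_apply, inner_sub_right, smul_apply,
        inner_smul_right, ContinuousLinearMap.comp_apply, (hR z hz).2, (hR z hz).2, (hR w hw).2]
      simp only [c]
      split_ifs with h
      · simp
      · have h1 : (b.energy i - z : ℝ) ≠ 0 := abs_pos.1 (by linarith [hne z hz i h])
        have h2 : (b.energy i - w : ℝ) ≠ 0 := abs_pos.1 (by linarith [hne w hw i h])
        have h3 : (b.energy i - z)⁻¹ - (b.energy i - w)⁻¹ =
          (z - w) * ((b.energy i - z)⁻¹ * (b.energy i - w)⁻¹) := by
          field_simp
          ring
        rw [← sub_mul, ← Complex.ofReal_sub, h3]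
        push_cast
        ring
    rw [this, norm_smul, Complex.norm_real, Real.norm_eq_abs, mul_comm, sq]
    refine mul_le_mul_of_nonneg_right ?_ (abs_nonneg _)
    exact (ContinuousLinearMap.opNorm_comp_le _ _).trans
      (mul_le_mul (hR z hz).1 (hR w hw).1 (norm_nonneg _) hc)
  · intro z hz x
    refine ext_inner_basis b.basis fun i => ?_
    rw [b.inner_proj_energySpace hH₀, (hR z hz).2, inner_zero_right]
    split_ifs with h
    · simp [c, h]
    · rfl
  · intro z hz K hK x hx
    exact b.apply_mem_of_isReducing hH₀ hbasis (hR z hz).2 hK hx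
  · intro z hz x y
    have h1 : x + R z y = proj (energySpace H₀ E₀) x ↔ ∀ i, inner ℂ (b.basis i) (x + R z y) =
        inner ℂ (b.basis i) (proj (energySpace H₀ E₀) x) :=
      ⟨fun h i => by rw [h], ext_inner_basis b.basis⟩
    have h2 : ((E₀ - z : ℝ) : ℂ) • proj (energySpace H₀ E₀) x + proj (energySpace H₀ E₀) y = 0 ↔
        ∀ i, inner ℂ (b.basis i) (((E₀ - z : ℝ) : ℂ) • proj (energySpace H₀ E₀) x +
          proj (energySpace H₀ E₀) y) = inner ℂ (b.basis i) 0 :=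
      ⟨fun h i => by rw [h], ext_inner_basis b.basis⟩
    rw [b.exists_apply_eq_iff hH₀, h1, h2, ← forall_and]
    refine forall_congr' fun i => ?_
    rw [inner_sub_right, inner_smul_right, inner_add_right, inner_add_right, inner_smul_right,
      (hR z hz).2, b.inner_proj_energySpace hH₀, b.inner_proj_energySpace hH₀, inner_zero_right]
    simp only [c]
    split_ifs with h
    · rw [h]
      push_cast
      constructor
      · intro h'
        exact ⟨by ring, by linear_combination -h'⟩
      · rintro ⟨-, h'⟩
        linear_combination -h'
    · have h3 : (b.energy i - z : ℂ) ≠ 0 := by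
        exact_mod_cast abs_pos.1 (by linarith [hne z hz i h])
      push_cast
      rw [mul_zero, add_zero, eq_self_iff_true, and_true]
      field_simp
      constructor <;> intro h' <;> linear_combination (-1 : ℂ) * h'

end EigenBasis

/-! ### The steps, their orthogonality and the action of V on them. -/

section Procedure

variable {E : Type*} [NormedAddCommGroup E] [InnerProductSpace ℂ E]

lemma hamiltonian_apply (H₀ : E →ₗ.[ℂ] E) (V : E →L[ℂ] E) (lam : ℝ)
    (x : (hamiltonian H₀ V lam).domain) :
    hamiltonian H₀ V lam x = H₀ ⟨x, x.2⟩ + (lam : ℂ) • V x := rfl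

variable [CompleteSpace E] {H₀ : E →ₗ.[ℂ] E} {V : E →L[ℂ] E} {E₀ : ℝ}

lemma inner_apply_comm (hV : IsSelfAdjoint V) (x y : E) : inner ℂ (V x) y = inner ℂ x (V y) :=
  (ContinuousLinearMap.isSelfAdjoint_iff_isSymmetric.1 hV) x y

/-- By symmetry of `V`, the orthogonal complement of an invariant subspace is invariant too. -/
lemma proj_apply_comm (hV : IsSelfAdjoint V) {K : Submodule ℂ E} (hK : IsClosed (K : Set E))
    (h : ∀ x ∈ K, V x ∈ K) (x : E) : proj K (V x) = V (proj K x) := by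
  have h1 : V (x - proj K x) ∈ Kᗮ := fun y hy => by
    rw [← inner_apply_comm hV]
    exact sub_proj_mem_orthogonal x _ (h y hy)
  have h2 := proj_eq_zero_iff.2 h1
  rwa [map_sub, map_sub, proj_of_mem (h _ (proj_mem hK x)), sub_eq_zero] at h2

variable (H₀ V E₀)

lemma truncSpace_succ (n : ℕ) : truncSpace H₀ V E₀ (n + 1) =
    (truncSpace H₀ V E₀ n ⊔ newStates H₀ V (step H₀ V E₀ n)).topologicalClosure := rfl

lemma step_succ (n : ℕ) : step H₀ V E₀ (n + 1) =
    truncSpace H₀ V E₀ (n + 1) ⊓ (truncSpace H₀ V E₀ n)ᗮ := rfl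

lemma truncSpace_mono : Monotone (truncSpace H₀ V E₀) :=
  monotone_nat_of_le_succ fun n => by
    rw [truncSpace_succ]
    exact le_sup_left.trans (Submodule.le_topologicalClosure _)

lemma step_le_truncSpace (n : ℕ) : step H₀ V E₀ n ≤ truncSpace H₀ V E₀ n := by
  cases n with
  | zero => exact le_rfl
  | succ n => rw [step_succ]; exact inf_le_left

variable {H₀ V E₀}

/-- The generators have definite energy, so a spectral projection fixes or kills each of them. This
is what the separation by energy in the procedure is for. -/
lemma proj_mem_newStates (hH₀ : IsSelfAdjoint H₀) {S : Submodule ℂ E} (e : ℝ) {x : E}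
    (hx : x ∈ newStates H₀ V S) : proj (energySpace H₀ e) x ∈ newStates H₀ V S := by
  have : newStates H₀ V S ≤
      (newStates H₀ V S).comap (proj (energySpace H₀ e) : E →ₗ[ℂ] E) := by
    refine Submodule.span_le.2 ?_
    rintro _ ⟨y, hy, f, rfl⟩
    have hmem := proj_mem (isClosed_energySpace hH₀ f) (V y)
    rw [SetLike.mem_coe, Submodule.mem_comap, ContinuousLinearMap.coe_coe]
    rcases eq_or_ne e f with rfl | hf
    · rw [proj_of_mem hmem]
      exact Submodule.subset_span ⟨y, hy, e, rfl⟩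
    · rw [proj_energySpace_of_ne hH₀ hf hmem]
      exact Submodule.zero_mem _
  exact this hx

lemma isReducing_truncSpace (hH₀ : IsSelfAdjoint H₀) (n : ℕ) :
    IsReducing H₀ (truncSpace H₀ V E₀ n) := by
  induction n with
  | zero => exact isReducing_energySpace hH₀ E₀
  | succ n ih =>
    rw [truncSpace_succ]
    refine isReducing_topologicalClosure fun e x hx => ?_
    obtain ⟨y, hy, z, hz, rfl⟩ := Submodule.mem_sup.1 hx
    rw [map_add]
    exact Submodule.add_mem_sup (ih.proj_mem e y hy) (proj_mem_newStates hH₀ e hz)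

lemma isReducing_step (hH₀ : IsSelfAdjoint H₀) (n : ℕ) : IsReducing H₀ (step H₀ V E₀ n) := by
  cases n with
  | zero => exact isReducing_energySpace hH₀ E₀
  | succ n =>
    rw [step_succ]
    exact (isReducing_truncSpace hH₀ _).inf (isReducing_truncSpace hH₀ n).orthogonal

/-- Subtracting from x in K_{n+1} its projection to K_n leaves a vector of step n + 1. So K_n is the
algebraic sum of its steps, and `L` need not be closed. -/
lemma truncSpace_le (hH₀ : IsSelfAdjoint H₀) {L : Submodule ℂ E} (n : ℕ)
    (h : ∀ m ≤ n, step H₀ V E₀ m ≤ L) : truncSpace H₀ V E₀ n ≤ L := by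
  induction n with
  | zero => exact h 0 le_rfl
  | succ n ih =>
    intro x hx
    have h1 := proj_mem (isReducing_truncSpace (V := V) (E₀ := E₀) hH₀ n).isClosed x
    have h2 : x - proj (truncSpace H₀ V E₀ n) x ∈ step H₀ V E₀ (n + 1) :=
      ⟨Submodule.sub_mem _ hx (truncSpace_mono H₀ V E₀ n.le_succ h1), sub_proj_mem_orthogonal x⟩
    rw [← sub_add_cancel x (proj (truncSpace H₀ V E₀ n) x)]
    exact L.add_mem (h _ le_rfl h2) (ih (fun m hm => h m (hm.trans n.le_succ)) h1)

lemma step_orthogonal {m n : ℕ} (hmn : m < n) {x y : E} (hx : x ∈ truncSpace H₀ V E₀ m)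
    (hy : y ∈ step H₀ V E₀ n) : inner ℂ x y = 0 := by
  obtain ⟨n, rfl⟩ : ∃ k, n = k + 1 := ⟨n - 1, by omega⟩
  rw [step_succ] at hy
  exact hy.2 x (truncSpace_mono H₀ V E₀ (by omega) hx)

lemma inner_step_eq_zero {m n : ℕ} (hmn : m ≠ n) {x y : E} (hx : x ∈ step H₀ V E₀ m)
    (hy : y ∈ step H₀ V E₀ n) : inner ℂ x y = 0 := by
  rcases hmn.lt_or_gt with h | h
  · exact step_orthogonal h (step_le_truncSpace H₀ V E₀ m hx) hy
  · rw [← inner_conj_symm, step_orthogonal h (step_le_truncSpace H₀ V E₀ n hy) hx, map_zero]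

/-- For `y` in step `m`, every energy component of `V y` is a new state. The closed space K_{m+1}
contains them all, hence `V y` itself. -/
lemma apply_mem_truncSpace (hH₀ : IsSelfAdjoint H₀)
    (hbasis : (⨆ e : ℝ, energySpace H₀ e).topologicalClosure = ⊤) {n : ℕ} {x : E}
    (hx : x ∈ truncSpace H₀ V E₀ n) : V x ∈ truncSpace H₀ V E₀ (n + 1) := by
  suffices truncSpace H₀ V E₀ n ≤
    (truncSpace H₀ V E₀ (n + 1)).comap (V : E →ₗ[ℂ] E) from this hx
  refine truncSpace_le hH₀ n fun m hm y hy => ?_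
  refine truncSpace_mono H₀ V E₀ (Nat.succ_le_succ hm) ?_
  refine mem_of_forall_proj_mem hH₀ hbasis (isReducing_truncSpace hH₀ _).isClosed fun e => ?_
  rw [truncSpace_succ]
  exact Submodule.le_topologicalClosure _
    (Submodule.mem_sup_right (Submodule.subset_span ⟨y, hy, e, rfl⟩))

lemma isReducing_generated (hH₀ : IsSelfAdjoint H₀) : IsReducing H₀ (generated H₀ V E₀) := by
  refine isReducing_topologicalClosure fun e => ?_
  have : (⨆ n, step H₀ V E₀ n) ≤
      (⨆ n, step H₀ V E₀ n).comap (proj (energySpace H₀ e) : E →ₗ[ℂ] E) :=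
    iSup_le fun n x hx =>
      Submodule.mem_iSup_of_mem n ((isReducing_step hH₀ n).proj_mem e x hx)
  exact this

lemma step_le_generated (n : ℕ) : step H₀ V E₀ n ≤ generated H₀ V E₀ :=
  (le_iSup _ n).trans (Submodule.le_topologicalClosure _)

lemma apply_mem_generated (hH₀ : IsSelfAdjoint H₀)
    (hbasis : (⨆ e : ℝ, energySpace H₀ e).topologicalClosure = ⊤) {x : E}
    (hx : x ∈ generated H₀ V E₀) : V x ∈ generated H₀ V E₀ := by
  suffices generated H₀ V E₀ ≤ (generated H₀ V E₀).comap (V : E →ₗ[ℂ] E) from this hx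
  refine Submodule.topologicalClosure_minimal _ (iSup_le fun n y hy => ?_)
    ((isReducing_generated hH₀).isClosed.preimage V.continuous)
  exact truncSpace_le hH₀ (n + 1) (fun m _ => step_le_generated m)
    (apply_mem_truncSpace hH₀ hbasis (step_le_truncSpace H₀ V E₀ n hy))

variable (V E₀)

lemma exists_stepBases (hH₀ : IsSelfAdjoint H₀)
    (hbasis : (⨆ e : ℝ, energySpace H₀ e).topologicalClosure = ⊤) :
    ∃ B : ℕ → Set E,
      Orthonormal ℂ (fun x : (⋃ n, B n) => (x : E)) ∧
      (Pairwise fun m n => Disjoint (B m) (B n)) ∧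
      (∀ n, (Submodule.span ℂ (B n)).topologicalClosure = step H₀ V E₀ n) ∧
      (∀ k, (Submodule.span ℂ (⋃ n ∈ Finset.range (k + 1), B n)).topologicalClosure =
        truncSpace H₀ V E₀ k) ∧
      ∀ n, ∀ x ∈ B n, ∃ e : ℝ, x ∈ energySpace H₀ e := by
  choose B ho hspan he using fun n =>
    (isReducing_step (V := V) (E₀ := E₀) hH₀ n).exists_orthonormal hH₀ hbasis
  have hmem : ∀ n, ∀ x ∈ B n, x ∈ step H₀ V E₀ n := fun n x hx => by
    rw [← hspan]
    exact Submodule.le_topologicalClosure _ (Submodule.subset_span hx)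
  refine ⟨B, ⟨?_, ?_⟩, ?_, hspan, fun k => le_antisymm ?_ ?_, he⟩
  · rintro ⟨x, hx⟩
    obtain ⟨n, hn⟩ := Set.mem_iUnion.1 hx
    exact (ho n).1 ⟨x, hn⟩
  · rintro ⟨x, hx⟩ ⟨y, hy⟩ hxy
    obtain ⟨m, hm⟩ := Set.mem_iUnion.1 hx
    obtain ⟨n, hn⟩ := Set.mem_iUnion.1 hy
    rcases eq_or_ne m n with rfl | hmn
    · exact (ho m).2 (i := ⟨x, hm⟩) (j := ⟨y, hn⟩) (by simpa using hxy)
    · exact inner_step_eq_zero hmn (hmem m x hm) (hmem n y hn)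
  · intro m n hmn
    refine Set.disjoint_left.2 fun x hm hn => (ho m).ne_zero ⟨x, hm⟩ ?_
    exact inner_self_eq_zero.1 (inner_step_eq_zero hmn (hmem m x hm) (hmem n x hn))
  · refine Submodule.topologicalClosure_minimal _ (Submodule.span_le.2 ?_)
      (isReducing_truncSpace hH₀ k).isClosed
    intro x hx
    simp only [Set.mem_iUnion, Finset.mem_range] at hx
    obtain ⟨n, hn, hx⟩ := hx
    exact truncSpace_mono H₀ V E₀ (Nat.lt_succ_iff.1 hn)
      (step_le_truncSpace H₀ V E₀ n (hmem n x hx))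
  · refine truncSpace_le hH₀ k fun m hm => ?_
    rw [← hspan]
    refine Submodule.topologicalClosure_mono (Submodule.span_mono ?_)
    exact Set.subset_biUnion_of_mem (u := B)
      (show m ∈ (Finset.range (k + 1) : Set ℕ) by simpa using Nat.lt_succ_iff.2 hm)

variable {V E₀}

/-- `H₀` preserves each step, so only `V` couples different ones; `V` raises the step by at most
one, and by symmetry lowers it by at most one. -/
lemma inner_hamiltonian_step (hH₀ : IsSelfAdjoint H₀)
    (hbasis : (⨆ e : ℝ, energySpace H₀ e).topologicalClosure = ⊤) (hV : IsSelfAdjoint V)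
    (lam : ℝ) (m n : ℕ) (x : E) (hx : x ∈ step H₀ V E₀ m) (y : (hamiltonian H₀ V lam).domain)
    (hy : (y : E) ∈ step H₀ V E₀ n) :
    (m ≠ n → inner ℂ x (hamiltonian H₀ V lam y) = lam * inner ℂ x (V y)) ∧
      (m + 1 < n ∨ n + 1 < m → inner ℂ x (hamiltonian H₀ V lam y) = 0) := by
  have h1 : m ≠ n → inner ℂ x (hamiltonian H₀ V lam y) = lam * inner ℂ x (V y) := fun hmn => by
    rw [hamiltonian_apply, inner_add_right, inner_smul_right,
      inner_step_eq_zero hmn hx ((isReducing_step hH₀ n).apply_mem hH₀ hbasis ⟨y, y.2⟩ hy),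
      zero_add]
  refine ⟨h1, fun h => ?_⟩
  rw [h1 (by omega)]
  rcases h with h | h
  · rw [← inner_apply_comm hV, step_orthogonal h
      (apply_mem_truncSpace hH₀ hbasis (step_le_truncSpace H₀ V E₀ m hx)) hy, mul_zero]
  · rw [← inner_conj_symm, step_orthogonal h
      (apply_mem_truncSpace hH₀ hbasis (step_le_truncSpace H₀ V E₀ n hy)) hx, map_zero, mul_zero]

lemma inner_eq_zero_of_forall_step (hH₀ : IsSelfAdjoint H₀)
    (hbasis : (⨆ e : ℝ, energySpace H₀ e).topologicalClosure = ⊤) {α : E}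
    (hα : ∀ n, ∀ x ∈ step H₀ V E₀ n, inner ℂ α x = 0) :
    (∀ n, ∀ x ∈ step H₀ V E₀ n, inner ℂ α (V x) = 0) ∧
      ∀ lam : ℝ, ∀ n, ∀ x : (hamiltonian H₀ V lam).domain, (x : E) ∈ step H₀ V E₀ n →
        inner ℂ α (hamiltonian H₀ V lam x) = 0 := by
  have h1 : ∀ n, ∀ x ∈ truncSpace H₀ V E₀ n, inner ℂ α x = 0 := fun n x hx =>
    Submodule.mem_orthogonal_singleton_iff_inner_right.1 (truncSpace_le hH₀ (L := (ℂ ∙ α)ᗮ) n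
      (fun m _ y hy => Submodule.mem_orthogonal_singleton_iff_inner_right.2 (hα m y hy)) hx)
  have h2 : ∀ n, ∀ x ∈ step H₀ V E₀ n, inner ℂ α (V x) = 0 := fun n x hx =>
    h1 _ _ (apply_mem_truncSpace hH₀ hbasis (step_le_truncSpace H₀ V E₀ n hx))
  refine ⟨h2, fun lam n x hx => ?_⟩
  rw [hamiltonian_apply, inner_add_right, inner_smul_right, h2 n x hx,
    hα n _ ((isReducing_step hH₀ n).apply_mem hH₀ hbasis ⟨x, x.2⟩ hx), mul_zero, add_zero]

lemma exists_proj_hamiltonian_apply (hH₀ : IsSelfAdjoint H₀)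
    (hbasis : (⨆ e : ℝ, energySpace H₀ e).topologicalClosure = ⊤) (hV : IsSelfAdjoint V)
    {K : Submodule ℂ E} (hK : IsReducing H₀ K) (hVK : ∀ x ∈ K, V x ∈ K) (lam : ℝ)
    (x : (hamiltonian H₀ V lam).domain) :
    ∃ hx : proj K (x : E) ∈ (hamiltonian H₀ V lam).domain,
      hamiltonian H₀ V lam ⟨_, hx⟩ = proj K (hamiltonian H₀ V lam x) := by
  obtain ⟨hx, h⟩ := hK.exists_proj_apply hH₀ hbasis ⟨x, x.2⟩
  refine ⟨hx, ?_⟩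
  rw [hamiltonian_apply, hamiltonian_apply, map_add, map_smul, proj_apply_comm hV hK.isClosed hVK]
  exact congrArg (· + _) h

end Procedure

/-! ### The wave operator and its resolvent identity. -/

section Wave

variable {E : Type*} [NormedAddCommGroup E] [InnerProductSpace ℂ E]

/-- The operator `(1 + lam R V)⁻¹`, which recovers perturbed eigenstates from their components in
the unperturbed energy space. -/
noncomputable def wave (R V : E →L[ℂ] E) (lam : ℝ) : E →L[ℂ] E :=
  Ring.inverse (1 + (lam : ℂ) • (R * V))

lemma norm_smul_apply_apply_le {R V : E →L[ℂ] E} {lam q : ℝ} (hq : |lam| * (‖R‖ * ‖V‖) ≤ q)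
    (x : E) : ‖(lam : ℂ) • R (V x)‖ ≤ q * ‖x‖ := by
  rw [norm_smul, Complex.norm_real, Real.norm_eq_abs]
  calc |lam| * ‖R (V x)‖ ≤ |lam| * (‖R‖ * (‖V‖ * ‖x‖)) := by
        gcongr
        exact (R.le_opNorm _).trans (by gcongr; exact V.le_opNorm x)
    _ = |lam| * (‖R‖ * ‖V‖) * ‖x‖ := by ring
    _ ≤ q * ‖x‖ := by gcongr

variable [CompleteSpace E] {R V : E →L[ℂ] E} {lam : ℝ}

lemma isUnit_one_add_smul (h : |lam| * (‖R‖ * ‖V‖) ≤ 1 / 4) :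
    IsUnit (1 + (lam : ℂ) • (R * V)) := by
  rw [← sub_neg_eq_add]
  refine isUnit_one_sub_of_norm_lt_one ?_
  rw [norm_neg, norm_smul, Complex.norm_real, Real.norm_eq_abs]
  have : |lam| * ‖R * V‖ ≤ |lam| * (‖R‖ * ‖V‖) := by gcongr; exact norm_mul_le _ _
  linarith

lemma wave_add (h : |lam| * (‖R‖ * ‖V‖) ≤ 1 / 4) (x : E) :
    wave R V lam x + (lam : ℂ) • R (V (wave R V lam x)) = x :=
  DFunLike.congr_fun (Ring.mul_inverse_cancel _ (isUnit_one_add_smul h)) x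

lemma wave_apply_add (h : |lam| * (‖R‖ * ‖V‖) ≤ 1 / 4) (x : E) :
    wave R V lam (x + (lam : ℂ) • R (V x)) = x :=
  DFunLike.congr_fun (Ring.inverse_mul_cancel _ (isUnit_one_add_smul h)) x

lemma wave_injective (h : |lam| * (‖R‖ * ‖V‖) ≤ 1 / 4) : Function.Injective (wave R V lam) :=
  fun x y hxy => by rw [← wave_add h x, ← wave_add h y, hxy]

lemma norm_wave_apply_le (h : |lam| * (‖R‖ * ‖V‖) ≤ 1 / 4) (x : E) :
    ‖wave R V lam x‖ ≤ 2 * ‖x‖ := by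
  have h1 := norm_smul_apply_apply_le h (wave R V lam x)
  have h2 : wave R V lam x = x - (lam : ℂ) • R (V (wave R V lam x)) :=
    eq_sub_of_add_eq (wave_add h x)
  have h3 := norm_sub_le x ((lam : ℂ) • R (V (wave R V lam x)))
  rw [← h2] at h3
  linarith [norm_nonneg x]

/-- The component `y` of the solution orthogonal to `K` satisfies y + λRVy ∈ K. Projecting to the
complement bounds ‖y‖ by ‖y‖/4, so y = 0. -/
lemma wave_mem (h : |lam| * (‖R‖ * ‖V‖) ≤ 1 / 4) {K : Submodule ℂ E} (hK : IsClosed (K : Set E))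
    (hRK : ∀ x ∈ K, R x ∈ K) (hVK : ∀ x ∈ K, V x ∈ K) {x : E} (hx : x ∈ K) :
    wave R V lam x ∈ K := by
  set t := wave R V lam x
  set y := t - proj K t with hy
  have hmem := proj_mem hK t
  have h1 : y + (lam : ℂ) • R (V y) ∈ K := by
    have h2 : y + (lam : ℂ) • R (V y) =
        x - (proj K t + (lam : ℂ) • R (V (proj K t))) := by
      rw [← wave_add h x, hy, map_sub, map_sub, smul_sub]
      abel
    rw [h2]
    exact K.sub_mem hx (K.add_mem hmem (K.smul_mem _ (hRK _ (hVK _ hmem))))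
  have hyK : y ∈ Kᗮ := sub_proj_mem_orthogonal t
  have h2 : y = -((lam : ℂ) • R (V y) - proj K ((lam : ℂ) • R (V y))) := by
    have := proj_of_mem h1
    rw [map_add, proj_eq_zero_iff.2 hyK, zero_add] at this
    rw [this]
    abel
  have h3 : ‖y‖ ≤ 1 / 4 * ‖y‖ := by
    conv_lhs => rw [h2, norm_neg]
    refine le_trans ?_ (norm_smul_apply_apply_le h y)
    have := Submodule.norm_starProjection_apply_le (K.topologicalClosureᗮ) ((lam : ℂ) • R (V y))
    rwa [Submodule.starProjection_orthogonal_val] at this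
  have h4 : y = 0 := norm_le_zero_iff.1 (by linarith [norm_nonneg y])
  rw [sub_eq_zero.1 h4]
  exact hmem

/-- Second resolvent identity for the matrix elements of `V (1 + lam R V)⁻¹`. -/
lemma inner_apply_wave_sub {R₁ R₂ V₁ V₂ : E →L[ℂ] E} (h₁ : |lam| * (‖R₁‖ * ‖V₁‖) ≤ 1 / 4)
    (h₂ : |lam| * (‖R₂‖ * ‖V₂‖) ≤ 1 / 4) (hR₂ : IsSelfAdjoint R₂) (hV₂ : IsSelfAdjoint V₂)
    (x y : E) :
    inner ℂ x (V₁ (wave R₁ V₁ lam y)) - inner ℂ (V₂ (wave R₂ V₂ lam x)) y =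
      inner ℂ (wave R₂ V₂ lam x) ((V₁ - V₂) (wave R₁ V₁ lam y)) +
        lam * inner ℂ (V₂ (wave R₂ V₂ lam x)) ((R₂ - R₁) (V₁ (wave R₁ V₁ lam y))) := by
  -- Each bare argument is written as (1 + λRV) applied to its wave vector, `x` with the second pair
  -- of operators and `y` with the first.
  conv_lhs =>
    enter [1]
    rw [← wave_add h₂ x]
  conv_lhs =>
    enter [2, 3]
    rw [← wave_add h₁ y]
  rw [inner_add_left, inner_add_right, inner_smul_left, inner_smul_right, Complex.conj_ofReal,
    inner_apply_comm hR₂, sub_apply, sub_apply, inner_sub_right, inner_sub_right,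
    ← inner_apply_comm hV₂ (wave R₂ V₂ lam x) (wave R₁ V₁ lam y)]
  ring

lemma inner_apply_wave_comm (h : |lam| * (‖R‖ * ‖V‖) ≤ 1 / 4) (hR : IsSelfAdjoint R)
    (hV : IsSelfAdjoint V) (x y : E) :
    inner ℂ (V (wave R V lam x)) y = inner ℂ x (V (wave R V lam y)) := by
  have := inner_apply_wave_sub h h hR hV x y
  rw [sub_self, sub_self, zero_apply, zero_apply, inner_zero_right, inner_zero_right, mul_zero,
    add_zero, sub_eq_zero] at this
  exact this.symm

end Wave

/-! ### The effective Hamiltonian and the dependence of its eigenvalues on R. -/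

section Effective

variable {E : Type*} [NormedAddCommGroup E] [InnerProductSpace ℂ E]

/-- The energy-dependent effective Hamiltonian on the unperturbed energy space `W`. -/
noncomputable def effective (W : Submodule ℂ E) [FiniteDimensional ℂ W] (E₀ : ℝ)
    (R V : E →L[ℂ] E) (lam : ℝ) : W →ₗ[ℂ] W :=
  (E₀ : ℂ) • LinearMap.id + (lam : ℂ) •
    ((W.orthogonalProjectionOnto ∘L V ∘L wave R V lam ∘L W.subtypeL : W →L[ℂ] W) : W →ₗ[ℂ] W)

variable (W : Submodule ℂ E) [FiniteDimensional ℂ W] (E₀ : ℝ)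

lemma inner_effective (R V : E →L[ℂ] E) (lam : ℝ) (x y : W) :
    inner ℂ x (effective W E₀ R V lam y) =
      E₀ * inner ℂ x y + lam * inner ℂ (x : E) (V (wave R V lam y)) := by
  simp [effective]

variable [CompleteSpace E]

lemma isSymmetric_effective {R V : E →L[ℂ] E} {lam : ℝ} (h : |lam| * (‖R‖ * ‖V‖) ≤ 1 / 4)
    (hR : IsSelfAdjoint R) (hV : IsSelfAdjoint V) : (effective W E₀ R V lam).IsSymmetric := by
  intro x y
  rw [← inner_conj_symm, inner_effective, inner_effective, map_add, map_mul, map_mul,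
    inner_conj_symm, inner_conj_symm, Complex.conj_ofReal, Complex.conj_ofReal,
    inner_apply_wave_comm h hR hV]

lemma abs_re_inner_effective_sub_le {R₁ R₂ V₁ V₂ : E →L[ℂ] E} {lam : ℝ}
    (h₂ : |lam| * (‖R₂‖ * ‖V₂‖) ≤ 1 / 4) (hR₂ : IsSelfAdjoint R₂) (hV₂ : IsSelfAdjoint V₂) (x : W) :
    |(inner ℂ x (effective W E₀ R₁ V₁ lam x - effective W E₀ R₂ V₂ lam x)).re| ≤
      |lam| * ‖inner ℂ (x : E) (V₁ (wave R₁ V₁ lam x)) -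
        inner ℂ (V₂ (wave R₂ V₂ lam x)) (x : E)‖ := by
  rw [inner_apply_wave_comm h₂ hR₂ hV₂, inner_sub_right, inner_effective, inner_effective,
    add_sub_add_left_eq_sub, ← mul_sub]
  refine (Complex.abs_re_le_norm _).trans_eq ?_
  rw [norm_mul, Complex.norm_real, Real.norm_eq_abs]

/-- With equal `V` only the R-term of the resolvent identity remains. It is at most 4(|λ|c‖V‖)²δ,
and the smallness threshold 1/4 makes this δ/4: the contraction constant in z. -/
lemma abs_sortedEig_effective_sub_le {R₁ R₂ V : E →L[ℂ] E} {lam c : ℝ}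
    (hV : IsSelfAdjoint V) (hR₁ : IsSelfAdjoint R₁) (hR₂ : IsSelfAdjoint R₂)
    (h₁ : |lam| * (‖R₁‖ * ‖V‖) ≤ 1 / 4) (h₂ : |lam| * (‖R₂‖ * ‖V‖) ≤ 1 / 4)
    (hc : |lam| * (c * ‖V‖) ≤ 1 / 4) (hc0 : 0 ≤ c) {δ : ℝ} (hR : ‖R₁ - R₂‖ ≤ c ^ 2 * δ)
    (hδ : 0 ≤ δ) (i : Fin (Module.finrank ℂ W)) :
    |sortedEig (effective W E₀ R₁ V lam) i - sortedEig (effective W E₀ R₂ V lam) i| ≤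
      1 / 4 * δ := by
  refine abs_sortedEig_sub_le (isSymmetric_effective W E₀ h₂ hR₂ hV)
    (isSymmetric_effective W E₀ h₁ hR₁ hV) (fun x => ?_) i
  refine (abs_re_inner_effective_sub_le W E₀ h₂ hR₂ hV x).trans ?_
  rw [inner_apply_wave_sub h₁ h₂ hR₂ hV, sub_self, zero_apply, inner_zero_right, zero_add, norm_mul,
    Complex.norm_real, Real.norm_eq_abs]
  have e1 : ‖V (wave R₂ V lam x)‖ ≤ ‖V‖ * (2 * ‖x‖) :=
    (V.le_opNorm _).trans (by gcongr; exact norm_wave_apply_le h₂ x)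
  have e2 : ‖V (wave R₁ V lam x)‖ ≤ ‖V‖ * (2 * ‖x‖) :=
    (V.le_opNorm _).trans (by gcongr; exact norm_wave_apply_le h₁ x)
  rw [← norm_neg, neg_sub] at hR
  calc |lam| * (|lam| * ‖inner ℂ (V (wave R₂ V lam x)) ((R₂ - R₁) (V (wave R₁ V lam x)))‖)
      ≤ |lam| * (|lam| * (‖V‖ * (2 * ‖x‖) * (c ^ 2 * δ * (‖V‖ * (2 * ‖x‖))))) := by
        gcongr
        refine (norm_inner_le_norm _ _).trans (mul_le_mul e1 ?_ (norm_nonneg _) (by positivity))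
        exact ((R₂ - R₁).le_opNorm _).trans (mul_le_mul hR e2 (norm_nonneg _) (by positivity))
    _ = (|lam| * (c * ‖V‖)) ^ 2 * (4 * δ * ‖x‖ ^ 2) := by ring
    _ ≤ (1 / 4) ^ 2 * (4 * δ * ‖x‖ ^ 2) := by gcongr
    _ = 1 / 4 * δ * ‖x‖ ^ 2 := by ring

lemma abs_sortedEig_effective_sub_const_le {R V : E →L[ℂ] E} {lam : ℝ} (hV : IsSelfAdjoint V)
    (hR : IsSelfAdjoint R) (h : |lam| * (‖R‖ * ‖V‖) ≤ 1 / 4)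
    (i : Fin (Module.finrank ℂ W)) :
    |sortedEig (effective W E₀ R V lam) i - E₀| ≤ 2 * (|lam| * ‖V‖) := by
  refine abs_sortedEig_sub_const_le (isSymmetric_effective W E₀ h hR hV) (fun x => ?_) i
  rw [inner_sub_right, inner_effective, inner_smul_right, add_sub_cancel_left]
  refine (Complex.abs_re_le_norm _).trans ?_
  rw [norm_mul, Complex.norm_real, Real.norm_eq_abs]
  calc |lam| * ‖inner ℂ (x : E) (V (wave R V lam x))‖
      ≤ |lam| * (‖x‖ * (‖V‖ * (2 * ‖x‖))) := by
        gcongr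
        refine (norm_inner_le_norm _ _).trans ?_
        refine mul_le_mul_of_nonneg_left ?_ (norm_nonneg _)
        exact (V.le_opNorm _).trans (by gcongr; exact norm_wave_apply_le h x)
    _ = 2 * (|lam| * ‖V‖) * ‖x‖ ^ 2 := by ring

end Effective

/-! ### Fixed points of sorted contracting functions. -/

section FixedPoints

/-- A monotone list of slowly varying functions has a monotone list of fixed points. -/
lemma exists_fixedPoints {n : ℕ} {m : ℝ → Fin n → ℝ} (hm : ∀ z, Monotone (m z)) {e r : ℝ}
    (hr : 0 < r) (hlip : ∀ z w, |z - e| < r → |w - e| < r → ∀ i,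
      |m z i - m w i| ≤ 1 / 4 * |z - w|) (hbd : ∀ z, |z - e| < r → ∀ i, |m z i - e| ≤ r / 2) :
    ∃ μ : Fin n → ℝ, Monotone μ ∧ ∀ i, |μ i - e| < r ∧ m (μ i) i = μ i ∧
      ∀ x, |x - e| < r → (m x i = x ↔ μ i = x) := by
  have hex : ∀ i, ∃ z, |z - e| < r ∧ m z i = z := by
    intro i
    -- The bound r/2 on the values forces a sign change of z - m z i on this closed interval inside
    -- the window.
    have hmem : ∀ z ∈ Set.Icc (e - r / 2) (e + r / 2), |z - e| < r := fun z hz => by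
      rw [abs_lt]; constructor <;> linarith [hz.1, hz.2]
    have hcont : ContinuousOn (fun z => z - m z i) (Set.Icc (e - r / 2) (e + r / 2)) := by
      refine continuousOn_id.sub (LipschitzOnWith.continuousOn (K := 1 / 4) ?_)
      refine LipschitzOnWith.of_dist_le_mul fun z hz w hw => ?_
      simpa [Real.dist_eq] using hlip z w (hmem z hz) (hmem w hw) i
    have hle : e - r / 2 ≤ e + r / 2 := by linarith
    have h1 := (abs_le.1 (hbd _ (hmem _ (Set.left_mem_Icc.2 hle)) i)).1
    have h2 := (abs_le.1 (hbd _ (hmem _ (Set.right_mem_Icc.2 hle)) i)).2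
    obtain ⟨z, hz, hz0⟩ := intermediate_value_Icc hle hcont
      (show (0 : ℝ) ∈ Set.Icc _ _ from ⟨by linarith, by linarith⟩)
    exact ⟨z, hmem z hz, by linarith [show z - m z i = 0 from hz0]⟩
  choose μ hμ hfix using hex
  refine ⟨μ, fun i j hij => ?_, fun i => ⟨hμ i, hfix i, fun x hx => ⟨fun h => ?_, ?_⟩⟩⟩
  -- If μ i > μ j with i ≤ j, then m(μ i) j ≥ m(μ i) i = μ i, while slope at most 1/4 from the fixed
  -- point μ j gives m(μ i) j < μ i.
  · by_contra! hlt
    have h1 := (abs_le.1 (hlip _ _ (hμ i) (hμ j) j)).2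
    rw [abs_of_pos (by linarith : 0 < μ i - μ j), hfix j] at h1
    have h2 := hm (μ i) hij
    rw [hfix i] at h2
    linarith
  · have h1 := hlip _ _ (hμ i) hx i
    rw [hfix i, h] at h1
    exact sub_eq_zero.1 (abs_eq_zero.1 (by linarith [abs_nonneg (μ i - x)]))
  · rintro rfl
    exact hfix i

end FixedPoints

/-! ### Reduction of the eigenvalue problem to the effective Hamiltonian. -/

section Levels

variable {E : Type*} [NormedAddCommGroup E] [InnerProductSpace ℂ E] [CompleteSpace E]
  {H₀ : E →ₗ.[ℂ] E} {V : E →L[ℂ] E} {E₀ r c lam : ℝ} {R : ℝ → E →L[ℂ] E}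

lemma coe_orthogonalProjectionOnto_eq_proj {W : Submodule ℂ E} [FiniteDimensional ℂ W] (x : E) :
    (W.orthogonalProjectionOnto x : E) = proj W x :=
  (Submodule.eq_starProjection_of_mem_orthogonal (proj_mem W.closed_of_finiteDimensional x)
    (sub_proj_mem_orthogonal x))

lemma IsReducedResolvent.small (hR : IsReducedResolvent H₀ E₀ r c R) {z : ℝ} (hz : |z - E₀| < r)
    (h : |lam| * (c * ‖V‖) ≤ 1 / 4) : |lam| * (‖R z‖ * ‖V‖) ≤ 1 / 4 := by
  refine le_trans ?_ h
  gcongr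
  exact hR.norm_le z hz

lemma IsReducedResolvent.mem_energySpace_hamiltonian_iff (hR : IsReducedResolvent H₀ E₀ r c R)
    {z : ℝ} (hz : |z - E₀| < r) (x : E) :
    x ∈ energySpace (hamiltonian H₀ V lam) z ↔
      x + (lam : ℂ) • R z (V x) = proj (energySpace H₀ E₀) x ∧
        ((E₀ - z : ℝ) : ℂ) • proj (energySpace H₀ E₀) x +
          (lam : ℂ) • proj (energySpace H₀ E₀) (V x) = 0 := by
  rw [← map_smul (R z), ← map_smul (proj _) (lam : ℂ), ← hR.exists_apply_eq_iff z hz,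
    mem_energySpace]
  refine exists_congr fun hx => ?_
  rw [hamiltonian_apply, eq_sub_iff_add_eq]

variable [FiniteDimensional ℂ (energySpace H₀ E₀)]

lemma mem_eigenspace_effective_iff {z : ℝ} (w : energySpace H₀ E₀) :
    w ∈ Module.End.eigenspace (effective (energySpace H₀ E₀) E₀ (R z) V lam) (z : ℂ) ↔
      ((E₀ - z : ℝ) : ℂ) • (w : E) +
        (lam : ℂ) • proj (energySpace H₀ E₀) (V (wave (R z) V lam w)) = 0 := by
  rw [Module.End.mem_eigenspace_iff, ← Subtype.coe_inj, ← sub_eq_zero,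
    ← coe_orthogonalProjectionOnto_eq_proj]
  simp only [effective, LinearMap.add_apply, LinearMap.smul_apply, Submodule.coe_add,
    Submodule.coe_smul, LinearMap.id_apply, ContinuousLinearMap.coe_coe,
    ContinuousLinearMap.comp_apply, Submodule.subtypeL_apply]
  push_cast
  rw [sub_smul, add_sub_right_comm]

/-- The wave operator and the projection to the unperturbed eigenspace are mutually inverse here: `R
z` has no component in that eigenspace, so the wave vector of `w` projects back to `w`. -/
lemma IsReducedResolvent.energySpace_hamiltonian_eq (hH₀ : IsSelfAdjoint H₀)
    (hR : IsReducedResolvent H₀ E₀ r c R) (h : |lam| * (c * ‖V‖) ≤ 1 / 4) {z : ℝ}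
    (hz : |z - E₀| < r) :
    energySpace (hamiltonian H₀ V lam) z =
      (Module.End.eigenspace (effective (energySpace H₀ E₀) E₀ (R z) V lam) (z : ℂ)).map
        ((wave (R z) V lam : E →ₗ[ℂ] E) ∘ₗ (energySpace H₀ E₀).subtype) := by
  have hs := hR.small hz h
  ext x
  rw [hR.mem_energySpace_hamiltonian_iff hz, Submodule.mem_map]
  constructor
  · rintro ⟨h1, h2⟩
    have h3 : wave (R z) V lam (proj (energySpace H₀ E₀) x) = x := by
      rw [← h1, wave_apply_add hs]
    refine ⟨⟨_, proj_mem (isClosed_energySpace hH₀ E₀) x⟩, ?_, h3⟩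
    rw [mem_eigenspace_effective_iff, h3]
    exact h2
  · rintro ⟨w, hw, rfl⟩
    rw [mem_eigenspace_effective_iff] at hw
    rw [LinearMap.comp_apply, Submodule.subtype_apply, ContinuousLinearMap.coe_coe]
    have h1 := wave_add hs (w : E)
    have h2 : proj (energySpace H₀ E₀) (wave (R z) V lam w) = w := by
      have := congrArg (proj (energySpace H₀ E₀)) h1
      rwa [map_add, map_smul, hR.proj_apply z hz, smul_zero, add_zero, proj_of_mem w.2] at this
    rw [h2]
    exact ⟨h1, hw⟩

lemma IsReducedResolvent.rank_energySpace (hH₀ : IsSelfAdjoint H₀) (hV : IsSelfAdjoint V)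
    (hR : IsReducedResolvent H₀ E₀ r c R) (h : |lam| * (c * ‖V‖) ≤ 1 / 4) {z : ℝ}
    (hz : |z - E₀| < r) :
    Module.rank ℂ (energySpace (hamiltonian H₀ V lam) z) =
      ((Finset.univ.filter fun i =>
        sortedEig (effective (energySpace H₀ E₀) E₀ (R z) V lam) i = z).card : Cardinal) := by
  have hs := hR.small hz h
  have hinj : Function.Injective
      ((wave (R z) V lam : E →ₗ[ℂ] E) ∘ₗ (energySpace H₀ E₀).subtype) :=
    (wave_injective hs).comp Subtype.val_injective
  rw [hR.energySpace_hamiltonian_eq hH₀ h hz,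
    card_filter_sortedEig (isSymmetric_effective _ _ hs (hR.isSelfAdjoint z hz) hV),
    Module.finrank_eq_rank]
  exact (LinearEquiv.rank_eq (Submodule.equivMapOfInjective _ hinj _)).symm

/-- The energies of the perturbed Hamiltonian near `E₀` are the fixed points of the sorted
eigenvalues of the effective Hamiltonian. -/
lemma IsReducedResolvent.exists_levels (hH₀ : IsSelfAdjoint H₀) (hV : IsSelfAdjoint V)
    (hR : IsReducedResolvent H₀ E₀ r c R) (hr : 0 < r) (h : |lam| * (c * ‖V‖) ≤ 1 / 4)
    (h' : |lam| * (4 * ‖V‖) ≤ r) :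
    ∃ μ : Fin (Module.finrank ℂ (energySpace H₀ E₀)) → ℝ, Monotone μ ∧
      IsEnergyList (hamiltonian H₀ V lam) E₀ r μ ∧ ∀ i, |μ i - E₀| < r ∧
        sortedEig (effective (energySpace H₀ E₀) E₀ (R (μ i)) V lam) i = μ i := by
  have hc : 0 ≤ c := (norm_nonneg _).trans (hR.norm_le E₀ (by simpa using hr))
  obtain ⟨μ, hmono, hμ⟩ := exists_fixedPoints
    (m := fun z => sortedEig (effective (energySpace H₀ E₀) E₀ (R z) V lam))
    (fun z => sortedEig_monotone _) hr
    (fun z w hz hw => abs_sortedEig_effective_sub_le _ _ hV (hR.isSelfAdjoint z hz)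
      (hR.isSelfAdjoint w hw) (hR.small hz h) (hR.small hw h) h hc (hR.norm_sub_le z w hz hw)
      (abs_nonneg _))
    (fun z hz i => (abs_sortedEig_effective_sub_const_le _ _ hV (hR.isSelfAdjoint z hz)
      (hR.small hz h) i).trans (by linarith))
  refine ⟨μ, hmono, ⟨fun i => (hμ i).1, fun x hx => ?_⟩, fun i => ⟨(hμ i).1, (hμ i).2.1⟩⟩
  rw [hR.rank_energySpace hH₀ hV h hx]
  congr 2
  ext i
  simpa using (hμ i).2.2 x hx

/-- Eigenvectors in the window are wave vectors of the unperturbed eigenspace. This serves the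
generated space with `V` and the truncated space with its compression. -/
lemma IsReducedResolvent.energySpace_hamiltonian_le (hH₀ : IsSelfAdjoint H₀)
    (hR : IsReducedResolvent H₀ E₀ r c R) (h : |lam| * (c * ‖V‖) ≤ 1 / 4) {K : Submodule ℂ E}
    (hK : IsReducing H₀ K) (hVK : ∀ x ∈ K, V x ∈ K) (hWK : energySpace H₀ E₀ ≤ K) {z : ℝ}
    (hz : |z - E₀| < r) : energySpace (hamiltonian H₀ V lam) z ≤ K := by
  rw [hR.energySpace_hamiltonian_eq hH₀ h hz]
  rintro _ ⟨w, -, rfl⟩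
  exact wave_mem (hR.small hz h) hK.isClosed (hR.apply_mem z hz K hK) hVK (hWK w.2)

end Levels

/-! ### The truncated problem and the product of two approximation errors. -/

section Truncation

variable {E : Type*} [NormedAddCommGroup E] [InnerProductSpace ℂ E] [CompleteSpace E]
  {H₀ : E →ₗ.[ℂ] E} (V : E →L[ℂ] E) {E₀ r c lam : ℝ} {R : ℝ → E →L[ℂ] E}

/-- The compression of `V` to a subspace, extended by zero. -/
noncomputable def compression (K : Submodule ℂ E) : E →L[ℂ] E := proj K ∘L V ∘L proj K

variable {V}

lemma isSelfAdjoint_compression (hV : IsSelfAdjoint V) (K : Submodule ℂ E) :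
    IsSelfAdjoint (compression V K) := by
  rw [ContinuousLinearMap.isSelfAdjoint_iff_isSymmetric]
  intro x y
  simp only [compression, ContinuousLinearMap.coe_coe, ContinuousLinearMap.comp_apply]
  rw [inner_proj_left, inner_apply_comm hV, inner_proj_left]

lemma norm_compression_le (K : Submodule ℂ E) : ‖compression V K‖ ≤ ‖V‖ := by
  refine ContinuousLinearMap.opNorm_le_bound _ (norm_nonneg _) fun x => ?_
  refine (norm_proj_apply_le K _).trans ((V.le_opNorm _).trans ?_)
  gcongr
  exact norm_proj_apply_le K x

lemma compression_apply_of_mem {K : Submodule ℂ E} {x : E} (hx : x ∈ K) :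
    compression V K x = proj K (V x) := by
  simp only [compression, ContinuousLinearMap.comp_apply, proj_of_mem hx]

lemma compression_apply_mem {K : Submodule ℂ E} (hK : IsClosed (K : Set E)) (x : E) :
    compression V K x ∈ K := proj_mem hK _

/-- The two operators agree on the truncated space, and it contains all eigenvectors of the second
one in the window. Hence the same `R` on the whole space treats both problems. -/
lemma IsReducedResolvent.energySpace_truncHamiltonian [FiniteDimensional ℂ (energySpace H₀ E₀)]
    (hH₀ : IsSelfAdjoint H₀)
    (hbasis : (⨆ e : ℝ, energySpace H₀ e).topologicalClosure = ⊤)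
    (hR : IsReducedResolvent H₀ E₀ r c R) (h : |lam| * (c * ‖V‖) ≤ 1 / 4) (k : ℕ) {z : ℝ}
    (hz : |z - E₀| < r) :
    energySpace (truncHamiltonian H₀ V E₀ k lam) z =
      energySpace (hamiltonian H₀ (compression V (truncSpace H₀ V E₀ k)) lam) z := by
  set K := truncSpace H₀ V E₀ k
  have hK : IsReducing H₀ K := isReducing_truncSpace hH₀ k
  have hc : 0 ≤ c := (norm_nonneg _).trans (hR.norm_le z hz)
  have hle := hR.energySpace_hamiltonian_le hH₀ (V := compression V K) (lam := lam) (by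
    refine le_trans ?_ h
    gcongr
    exact norm_compression_le K) hK (fun x _ => compression_apply_mem hK.isClosed x)
    (truncSpace_mono H₀ V E₀ k.zero_le) hz
  have key : ∀ x : E, ∀ hx : x ∈ H₀.domain, ∀ hxK : x ∈ K,
      truncHamiltonian H₀ V E₀ k lam ⟨x, hx, hxK⟩ =
        hamiltonian H₀ (compression V K) lam ⟨x, hx⟩ := fun x hx hxK => by
    rw [hamiltonian_apply, compression_apply_of_mem hxK, ← map_smul]
    conv_rhs => rw [← proj_of_mem (hK.apply_mem hH₀ hbasis ⟨x, hx⟩ hxK), ← map_add]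
    rfl
  ext x
  rw [mem_energySpace, mem_energySpace]
  constructor
  · rintro ⟨⟨hx, hxK⟩, h1⟩
    exact ⟨hx, (key x hx hxK).symm.trans h1⟩
  · intro hx
    have hxK := hle (mem_energySpace.2 hx)
    obtain ⟨hx, h1⟩ := hx
    exact ⟨⟨hx, hxK⟩, (key x hx hxK).trans h1⟩

/-- The perturbed eigenstates are approximated to increasing order within the spaces generated by
the procedure. -/
lemma exists_mem_norm_wave_sub_le {R V' : E →L[ℂ] E} {q : ℝ} {K : ℕ → Submodule ℂ E} {n : ℕ}
    (hKm : Monotone K) (hRK : ∀ j, ∀ x ∈ K j, R x ∈ K j)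
    (hVK : ∀ j < n, ∀ x ∈ K j, V' x ∈ K (j + 1)) (h : |lam| * (‖R‖ * ‖V'‖) ≤ 1 / 4)
    (hq : |lam| * (‖R‖ * ‖V'‖) ≤ q) {x : E} (hx : x ∈ K 0) {j : ℕ} (hj : j ≤ n) :
    ∃ u ∈ K j, ‖wave R V' lam x - u‖ ≤ q ^ (j + 1) * (2 * ‖x‖) := by
  have hq0 : 0 ≤ q := le_trans (by positivity) hq
  set t := wave R V' lam x with ht
  -- `t` is the fixed point of u ↦ x - λRV'u. Each iteration gains a factor `q` and costs one step;
  -- `x`, the iterate of 0, already has error of order `q`, hence the exponent j + 1.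
  have hA : ∀ u, ‖t - (x - (lam : ℂ) • R (V' u))‖ ≤ q * ‖t - u‖ := fun u => by
    have h1 : t - (x - (lam : ℂ) • R (V' u)) = -((lam : ℂ) • R (V' (t - u))) := by
      rw [← wave_add h x, ← ht, map_sub, map_sub, smul_sub]
      abel
    rw [h1, norm_neg]
    exact norm_smul_apply_apply_le hq _
  induction j with
  | zero =>
    refine ⟨x, hx, ?_⟩
    have := hA 0
    rw [map_zero, map_zero, smul_zero, sub_zero, sub_zero] at this
    rw [zero_add, pow_one]
    exact this.trans (by gcongr; exact norm_wave_apply_le h x)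
  | succ j ih =>
    obtain ⟨u, hu, hu'⟩ := ih (by omega)
    refine ⟨x - (lam : ℂ) • R (V' u), Submodule.sub_mem _ (hKm (Nat.zero_le _) hx)
      (Submodule.smul_mem _ _ (hRK _ _ (hVK j (by omega) u hu))), (hA u).trans ?_⟩
    rw [pow_succ', mul_assoc]
    gcongr

lemma norm_inner_wave_sub_le {R : E →L[ℂ] E} {q : ℝ} {K : ℕ → Submodule ℂ E} {k : ℕ}
    (hKm : Monotone K) (hKc : IsClosed (K k : Set E)) (hRK : ∀ j, ∀ x ∈ K j, R x ∈ K j)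
    (hVK : ∀ j, ∀ x ∈ K j, V x ∈ K (j + 1)) (hR : IsSelfAdjoint R) (hV : IsSelfAdjoint V)
    (h : |lam| * (‖R‖ * ‖V‖) ≤ 1 / 4) (hq : |lam| * (‖R‖ * ‖V‖) ≤ q) {x : E} (hx : x ∈ K 0) :
    ‖inner ℂ x (V (wave R V lam x)) -
        inner ℂ (compression V (K k) (wave R (compression V (K k)) lam x)) x‖ ≤
      ‖V‖ * q ^ (2 * k + 1) * (4 * ‖x‖ ^ 2) := by
  have hq0 : 0 ≤ q := le_trans (by positivity) hq
  have hle : |lam| * (‖R‖ * ‖compression V (K k)‖) ≤ |lam| * (‖R‖ * ‖V‖) := by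
    gcongr
    exact norm_compression_le _
  rw [inner_apply_wave_sub h (hle.trans h) hR (isSelfAdjoint_compression hV _), sub_self,
    zero_apply, inner_zero_right, mul_zero, add_zero]
  set t := wave R V lam x
  set s := wave R (compression V (K k)) lam x with hs
  have hsK : s ∈ K k := wave_mem (hle.trans h) hKc (hRK k)
    (fun y _ => compression_apply_mem hKc y) (hKm k.zero_le hx)
  obtain ⟨u, hu, hut⟩ := exists_mem_norm_wave_sub_le (n := k) hKm hRK (fun j _ => hVK j) h hq hx
    le_rfl
  -- `V v` must stay in `K k`, so `v` comes from one step earlier and one order is lost. For k = 0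
  -- there is no earlier step, and v = 0 suffices. Below the cut the compression acts as `V`, so the
  -- same iteration applies to `s`.
  have hv : ∃ v, V v ∈ K k ∧ ‖s - v‖ ≤ q ^ k * (2 * ‖x‖) := by
    rcases k with _ | k
    · refine ⟨0, by rw [map_zero]; exact Submodule.zero_mem _, ?_⟩
      rw [sub_zero, pow_zero, one_mul]
      exact norm_wave_apply_le (hle.trans h) x
    · obtain ⟨v, hv, hvs⟩ := exists_mem_norm_wave_sub_le (V' := compression V (K (k + 1)))
        (n := k + 1) hKm hRK (fun j hj y hy => by
          have hy' := hVK j y hy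
          rwa [compression_apply_of_mem (hKm hj.le hy), proj_of_mem (hKm hj hy')])
        (hle.trans h) (hle.trans hq) hx k.le_succ
      exact ⟨v, hVK k v hv, hvs⟩
  obtain ⟨v, hv, hvs⟩ := hv
  have horth : t - proj (K k) t ∈ (K k)ᗮ := sub_proj_mem_orthogonal t
  -- As `s` lies in `K k`, the truncation error sees only the part of `t` orthogonal to `K k`; `V v`
  -- is orthogonal to that part and can be subtracted freely.
  have h1 : inner ℂ s ((V - compression V (K k)) t) =
      inner ℂ (V (s - v)) (t - proj (K k) t) := by
    rw [map_sub, inner_sub_left, horth _ hv, sub_zero, inner_apply_comm hV, sub_apply, map_sub,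
      inner_sub_right, inner_sub_right]
    congr 1
    simp only [compression, ContinuousLinearMap.comp_apply]
    rw [← inner_proj_left, proj_of_mem hsK]
  have h2 : ‖t - proj (K k) t‖ ≤ q ^ (k + 1) * (2 * ‖x‖) := by
    refine le_trans ?_ hut
    have h3 : t - proj (K k) t = (t - u) - proj (K k) (t - u) := by
      rw [map_sub, proj_of_mem hu]; abel
    rw [h3]
    have := Submodule.norm_starProjection_apply_le ((K k).topologicalClosureᗮ) (t - u)
    rwa [Submodule.starProjection_orthogonal_val] at this
  rw [h1]
  calc ‖inner ℂ (V (s - v)) (t - proj (K k) t)‖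
      ≤ ‖V‖ * (q ^ k * (2 * ‖x‖)) * (q ^ (k + 1) * (2 * ‖x‖)) := by
        refine (norm_inner_le_norm _ _).trans (mul_le_mul ?_ h2 (norm_nonneg _) (by positivity))
        exact (V.le_opNorm _).trans (by gcongr)
    _ = ‖V‖ * q ^ (2 * k + 1) * (4 * ‖x‖ ^ 2) := by ring

end Truncation

/-! ### Comparison of the exact and truncated energies. -/

section Accuracy

variable {E : Type*} [NormedAddCommGroup E] [InnerProductSpace ℂ E] [CompleteSpace E]
  {H₀ : E →ₗ.[ℂ] E} {V : E →L[ℂ] E} {E₀ r c : ℝ} {R : ℝ → E →L[ℂ] E}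

lemma eventually_small (hr : 0 < r) (a b : ℝ) :
    ∀ᶠ lam : ℝ in 𝓝 0, |lam| * a ≤ 1 / 4 ∧ |lam| * b ≤ r := by
  have ht : ∀ a : ℝ, Tendsto (fun lam : ℝ => |lam| * a) (𝓝 0) (𝓝 0) := fun a => by
    have : Continuous fun lam : ℝ => |lam| * a := by fun_prop
    simpa using this.tendsto 0
  exact ((ht a).eventually_le_const (by norm_num)).and ((ht b).eventually_le_const hr)

variable [FiniteDimensional ℂ (energySpace H₀ E₀)]

/-- Insert the eigenvalue for `V` at parameter `ν`. The change of parameter costs |μ - ν|/4,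
absorbed on the left, and the change of `V` costs the truncation error; 4 / (3/4) is rounded up to
8. -/
lemma IsReducedResolvent.abs_level_sub_le (hH₀ : IsSelfAdjoint H₀)
    (hbasis : (⨆ e : ℝ, energySpace H₀ e).topologicalClosure = ⊤) (hV : IsSelfAdjoint V)
    (hR : IsReducedResolvent H₀ E₀ r c R) {lam : ℝ} (h : |lam| * (c * ‖V‖) ≤ 1 / 4) (k : ℕ)
    {i : Fin (Module.finrank ℂ (energySpace H₀ E₀))} {μ ν : ℝ} (hμr : |μ - E₀| < r)
    (hμ : sortedEig (effective (energySpace H₀ E₀) E₀ (R μ) V lam) i = μ) (hνr : |ν - E₀| < r)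
    (hν : sortedEig (effective (energySpace H₀ E₀) E₀ (R ν)
      (compression V (truncSpace H₀ V E₀ k)) lam) i = ν) :
    |μ - ν| ≤ 8 * ‖V‖ * (c * ‖V‖) ^ (2 * k + 1) * |lam| ^ (2 * k + 2) := by
  have hc : 0 ≤ c := (norm_nonneg _).trans (hR.norm_le μ hμr)
  have hle : |lam| * (c * ‖compression V (truncSpace H₀ V E₀ k)‖) ≤ 1 / 4 := by
    refine le_trans ?_ h
    gcongr
    exact norm_compression_le _
  have h1 := abs_sortedEig_effective_sub_le (energySpace H₀ E₀) E₀ hV (hR.isSelfAdjoint μ hμr)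
    (hR.isSelfAdjoint ν hνr) (hR.small hμr h) (hR.small hνr h) h hc
    (hR.norm_sub_le μ ν hμr hνr) (abs_nonneg _) i
  have hq : |lam| * (‖R ν‖ * ‖V‖) ≤ |lam| * (c * ‖V‖) := by
    gcongr
    exact hR.norm_le ν hνr
  have h2 := abs_sortedEig_sub_le (δ := |lam| * (‖V‖ * (|lam| * (c * ‖V‖)) ^ (2 * k + 1) * 4))
    (isSymmetric_effective (energySpace H₀ E₀) E₀ (hR.small hνr hle) (hR.isSelfAdjoint ν hνr)
      (isSelfAdjoint_compression hV (truncSpace H₀ V E₀ k)))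
    (isSymmetric_effective (energySpace H₀ E₀) E₀ (hR.small hνr h) (hR.isSelfAdjoint ν hνr) hV)
    (fun x => by
      refine (abs_re_inner_effective_sub_le _ _ (hR.small hνr hle) (hR.isSelfAdjoint ν hνr)
        (isSelfAdjoint_compression hV _) x).trans ?_
      rw [mul_assoc |lam|, mul_assoc _ 4]
      refine mul_le_mul_of_nonneg_left ?_ (abs_nonneg _)
      exact norm_inner_wave_sub_le (truncSpace_mono H₀ V E₀)
        (isReducing_truncSpace hH₀ k).isClosed
        (fun j => hR.apply_mem ν hνr _ (isReducing_truncSpace hH₀ j))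
        (fun j x hx => apply_mem_truncSpace hH₀ hbasis hx) (hR.isSelfAdjoint ν hνr) hV
        (hR.small hνr h) hq x.2) i
  rw [hμ] at h1
  rw [hν] at h2
  have h3 := abs_sub_le μ (sortedEig (effective (energySpace H₀ E₀) E₀ (R ν) V lam) i) ν
  have h4 : |lam| * (‖V‖ * (|lam| * (c * ‖V‖)) ^ (2 * k + 1) * 4) =
      4 * ‖V‖ * (c * ‖V‖) ^ (2 * k + 1) * |lam| ^ (2 * k + 2) := by ring
  have h5 : 0 ≤ ‖V‖ * (c * ‖V‖) ^ (2 * k + 1) * |lam| ^ (2 * k + 2) := by positivity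
  linarith

lemma IsReducedResolvent.exists_level_functions (hH₀ : IsSelfAdjoint H₀) (hV : IsSelfAdjoint V)
    (hR : IsReducedResolvent H₀ E₀ r c R) (hr : 0 < r) :
    ∃ μ : ℝ → Fin (Module.finrank ℂ (energySpace H₀ E₀)) → ℝ, ∀ᶠ lam in 𝓝 0,
      Monotone (μ lam) ∧ IsEnergyList (hamiltonian H₀ V lam) E₀ r (μ lam) ∧
        ∀ i, |μ lam i - E₀| < r ∧
          sortedEig (effective (energySpace H₀ E₀) E₀ (R (μ lam i)) V lam) i = μ lam i := by
  have h : ∀ lam : ℝ, ∃ μ : Fin (Module.finrank ℂ (energySpace H₀ E₀)) → ℝ,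
      |lam| * (c * ‖V‖) ≤ 1 / 4 ∧ |lam| * (4 * ‖V‖) ≤ r → Monotone μ ∧
        IsEnergyList (hamiltonian H₀ V lam) E₀ r μ ∧ ∀ i, |μ i - E₀| < r ∧
          sortedEig (effective (energySpace H₀ E₀) E₀ (R (μ i)) V lam) i = μ i := fun lam => by
    by_cases hs : |lam| * (c * ‖V‖) ≤ 1 / 4 ∧ |lam| * (4 * ‖V‖) ≤ r
    · obtain ⟨μ, hμ⟩ := hR.exists_levels hH₀ hV hr hs.1 hs.2
      exact ⟨μ, fun _ => hμ⟩
    · exact ⟨0, fun h => absurd h hs⟩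
  choose μ hμ using h
  exact ⟨μ, (eventually_small hr _ _).mono hμ⟩

lemma IsReducedResolvent.exists_energyLists (hH₀ : IsSelfAdjoint H₀)
    (hbasis : (⨆ e : ℝ, energySpace H₀ e).topologicalClosure = ⊤) (hV : IsSelfAdjoint V)
    (hR : IsReducedResolvent H₀ E₀ r c R) (hr : 0 < r) :
    ∃ μ : ℝ → Fin (Module.finrank ℂ (energySpace H₀ E₀)) → ℝ,
      (∀ᶠ lam : ℝ in 𝓝 0, Monotone (μ lam) ∧
        IsEnergyList (hamiltonian H₀ V lam) E₀ r (μ lam)) ∧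
      ∀ k : ℕ, ∃ ν : ℝ → Fin (Module.finrank ℂ (energySpace H₀ E₀)) → ℝ,
        (∀ᶠ lam : ℝ in 𝓝 0, Monotone (ν lam) ∧
          IsEnergyList (truncHamiltonian H₀ V E₀ k lam) E₀ r (ν lam)) ∧
        ∀ i, (fun lam => μ lam i - ν lam i) =O[𝓝 0] (fun lam : ℝ => lam ^ (2 * k + 2)) := by
  obtain ⟨μ, hμ⟩ := hR.exists_level_functions hH₀ hV hr
  refine ⟨μ, hμ.mono fun lam h => ⟨h.1, h.2.1⟩, fun k => ?_⟩
  -- The existence result is applied to the compressed perturbation; its energies are identified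
  -- with those of the truncated Hamiltonian below.
  obtain ⟨ν, hν⟩ := hR.exists_level_functions hH₀
    (isSelfAdjoint_compression hV (truncSpace H₀ V E₀ k)) hr
  have hsmall := eventually_small hr (c * ‖V‖) 0
  refine ⟨ν, ?_, fun i => IsBigO.of_bound (8 * ‖V‖ * (c * ‖V‖) ^ (2 * k + 1)) ?_⟩
  · filter_upwards [hν, hsmall] with lam h hs
    exact ⟨h.1, (isEnergyList_congr fun z hz =>
      hR.energySpace_truncHamiltonian hH₀ hbasis hs.1 k hz).2 h.2.1⟩
  · filter_upwards [hμ, hν, hsmall] with lam h1 h2 hs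
    rw [norm_pow, Real.norm_eq_abs, Real.norm_eq_abs]
    exact hR.abs_level_sub_le hH₀ hbasis hV hs.1 k (h1.2.2 i).1 (h1.2.2 i).2 (h2.2.2 i).1
      (h2.2.2 i).2

end Accuracy

end SCE

theorem mainTheorem3 {E : Type*} [NormedAddCommGroup E] [InnerProductSpace ℂ E] [CompleteSpace E]
    (H₀ : E →ₗ.[ℂ] E) (hH₀ : IsSelfAdjoint H₀)
    -- the eigenstates of the unperturbed Hamiltonian span the Hilbert space
    (hbasis : (⨆ e : ℝ, SCE.energySpace H₀ e).topologicalClosure = ⊤)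
    (V : E →L[ℂ] E) (hV : IsSelfAdjoint V)
    -- the target unperturbed energy: finitely degenerate and isolated
    (E₀ : ℝ) [FiniteDimensional ℂ (SCE.energySpace H₀ E₀)]
    (d : ℝ) (hgap : ∀ e : ℝ, e ≠ E₀ → SCE.energySpace H₀ e ≠ ⊥ → d ≤ |e - E₀|)
    (r : ℝ) (hr : 0 < r) (hrd : r < d) :
    -- the steps are spanned by states that together are orthonormal eigenstates of `H₀`
    (∃ B : ℕ → Set E,
      Orthonormal ℂ (fun x : (⋃ n, B n) => (x : E)) ∧
      (Pairwise fun m n => Disjoint (B m) (B n)) ∧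
      (∀ n, (Submodule.span ℂ (B n)).topologicalClosure = SCE.step H₀ V E₀ n) ∧
      (∀ k, (Submodule.span ℂ (⋃ n ∈ Finset.range (k + 1), B n)).topologicalClosure =
        SCE.truncSpace H₀ V E₀ k) ∧
      ∀ n, ∀ x ∈ B n, ∃ e : ℝ, x ∈ SCE.energySpace H₀ e) ∧
    -- the Hamiltonian is tri-block-diagonal
    (∀ lam : ℝ, ∀ m n : ℕ, ∀ x ∈ SCE.step H₀ V E₀ m, ∀ y : (SCE.hamiltonian H₀ V lam).domain,
      (y : E) ∈ SCE.step H₀ V E₀ n →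
        (m ≠ n → inner ℂ x (SCE.hamiltonian H₀ V lam y) = lam * inner ℂ x (V y)) ∧
        (m + 1 < n ∨ n + 1 < m → inner ℂ x (SCE.hamiltonian H₀ V lam y) = 0)) ∧
    -- the states that are not generated decouple
    (∀ α : E, (∀ n, ∀ x ∈ SCE.step H₀ V E₀ n, inner ℂ α x = 0) →
      (∀ n, ∀ x ∈ SCE.step H₀ V E₀ n, inner ℂ α (V x) = 0) ∧
      ∀ lam : ℝ, ∀ n, ∀ x : (SCE.hamiltonian H₀ V lam).domain, (x : E) ∈ SCE.step H₀ V E₀ n →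
        inner ℂ α (SCE.hamiltonian H₀ V lam x) = 0) ∧
    (∀ lam : ℝ, ∀ x : (SCE.hamiltonian H₀ V lam).domain,
      ∃ hx : SCE.proj (SCE.generated H₀ V E₀) (x : E) ∈ (SCE.hamiltonian H₀ V lam).domain,
        SCE.hamiltonian H₀ V lam ⟨_, hx⟩ =
          SCE.proj (SCE.generated H₀ V E₀) (SCE.hamiltonian H₀ V lam x)) ∧
    (∀ᶠ lam : ℝ in 𝓝 0, ∀ x : ℝ, |x - E₀| < r →
      SCE.energySpace (SCE.hamiltonian H₀ V lam) x ≤ SCE.generated H₀ V E₀) ∧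
    -- the energies of the target subspace are reproduced up to order `2 k + 1`
    (∃ μ : ℝ → Fin (Module.finrank ℂ (SCE.energySpace H₀ E₀)) → ℝ,
      (∀ᶠ lam : ℝ in 𝓝 0, Monotone (μ lam) ∧
        SCE.IsEnergyList (SCE.hamiltonian H₀ V lam) E₀ r (μ lam)) ∧
      ∀ k : ℕ, ∃ ν : ℝ → Fin (Module.finrank ℂ (SCE.energySpace H₀ E₀)) → ℝ,
        (∀ᶠ lam : ℝ in 𝓝 0, Monotone (ν lam) ∧
          SCE.IsEnergyList (SCE.truncHamiltonian H₀ V E₀ k lam) E₀ r (ν lam)) ∧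
        ∀ i, (fun lam => μ lam i - ν lam i) =O[𝓝 0] (fun lam : ℝ => lam ^ (2 * k + 2))) ∧
    -- the perturbation corrections up to order `2 k + 1` agree
    (∀ k : ℕ, ∀ μ ν : Fin (Module.finrank ℂ (SCE.energySpace H₀ E₀)) → ℝ → ℝ,
      (∀ i, AnalyticAt ℝ (μ i) 0) → (∀ i, AnalyticAt ℝ (ν i) 0) →
      (∀ᶠ lam : ℝ in 𝓝 0,
        SCE.IsEnergyList (SCE.hamiltonian H₀ V lam) E₀ r (fun i => μ i lam)) →
      (∀ᶠ lam : ℝ in 𝓝 0,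
        SCE.IsEnergyList (SCE.truncHamiltonian H₀ V E₀ k lam) E₀ r (fun i => ν i lam)) →
      ∃ σ : Equiv.Perm (Fin (Module.finrank ℂ (SCE.energySpace H₀ E₀))),
        ∀ i, ∀ m ≤ 2 * k + 1, iteratedDeriv m (μ i) 0 = iteratedDeriv m (ν (σ i)) 0) := by
  obtain ⟨R, hR⟩ := SCE.exists_isReducedResolvent hH₀ hbasis hgap hrd
  have hlists := hR.exists_energyLists hH₀ hbasis hV hr
  refine ⟨SCE.exists_stepBases V E₀ hH₀ hbasis, SCE.inner_hamiltonian_step hH₀ hbasis hV,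
    fun α hα => SCE.inner_eq_zero_of_forall_step hH₀ hbasis hα,
    SCE.exists_proj_hamiltonian_apply hH₀ hbasis hV (SCE.isReducing_generated hH₀)
      (fun x hx => SCE.apply_mem_generated hH₀ hbasis hx), ?_, hlists, ?_⟩
  · filter_upwards [SCE.eventually_small hr ((d - r)⁻¹ * ‖V‖) 0] with lam hlam x hx
    exact hR.energySpace_hamiltonian_le hH₀ hlam.1 (SCE.isReducing_generated hH₀)
      (fun x hx => SCE.apply_mem_generated hH₀ hbasis hx) (SCE.step_le_generated 0) hx
  · intro k μ ν hμ hν hμl hνl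
    obtain ⟨μ', hμ', h⟩ := hlists
    obtain ⟨ν', hν', hO⟩ := h k
    obtain ⟨σ, hσ⟩ := SCE.exists_perm_iteratedDeriv_eq hμ' hν' hO hμ hν hμl hνl
    -- Agreement of the sorted lists to order 2k + 2 controls the coefficients strictly below that
    -- order.
    exact ⟨σ, fun i m hm => hσ i m (by omega)⟩
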